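/- All graphs are finite and simple and have at least one vertex. For a graph $G$ write $v(G)$ for its number of vertices, $m_k(G)$ for the number of its matchings with exactly $k$ edges, $\mathbb M(G)=\sum_{k} m_k(G)$ for the number of all its matchings, and $$\mu(G,x)=\sum_{k=0}^{\lfloor v(G)/2\rfloor}(-1)^k m_k(G)\,x^{v(G)-2k}$$ for its matching polynomial. A pair $(G,d)$ is admissible if $d\ge 1$ is real and all degrees of $G$ are at most $d$. The matching measure $\rho_{G,d}$ of an admissible pair is the uniform distribution on the points $\lambda/\sqrt d$, where $\lambda$ runs over the roots of $\mu(G,x)$ with multiplicity. For a connected graph $F$ let $$t(F,G,d)=\frac{\hom(F,G)}{v(G)\,d^{\,v(F)-1}},$$ where $\hom(F,G)$ is the number of graph homomorphisms from $F$ to $G$. For $0\le\alpha\le1$, a sequence $(G_n,d_n)$ of admissible pairs is $\alpha$-regular if the degree of a uniform random vertex of $G_n$, divided by $d_n$, tends to $\alpha$ in probability. The semicircle distribution on $[-2\beta,2\beta]$ ($\beta\ge0$) is the law of $\beta X$, where $X$ has density $\frac1{2\pi}\sqrt{4-x^2}$ on $[-2,2]$; for $\beta=0$ it is the point mass at $0$.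 **Theorem.** Let $(G_n,d_n)$ be a sequence of admissible pairs with $d_n\to\infty$, and let $\rho_n=\rho_{G_n,d_n}$. All roots of the polynomials $\mu(G_n,x)$ are real, so the $\rho_n$ are probability measures on $\mathbb R$. Moreover: (a) If $t(F,G_n,d_n)$ converges as $n\to\infty$ for every finite tree $F$, then $\rho_n$ converges weakly to a probability measure $\rho$ supported on $[-2,2]$, and $$\limsup_{n\to\infty}\,\log\frac{\mathbb M(G_n)^{2/v(G_n)}}{d_n}\;\le\;2\int_{-2}^{2}\log|x|\,\mathrm d\rho(x),$$ where $\log 0=-\infty$ and both sides are extended real numbers, which may equal $-\infty$. (b) If the sequence $(G_n,d_n)$ is $\alpha$-regular for some $0\le\alpha\le1$, then $\rho_n$ converges weakly to the semicircle distribution on $[-2\sqrt\alpha,2\sqrt\alpha]$ (which is thus the measure $\rho$ of (a)), and $$\limsup_{n\to\infty}\,\frac{\mathbb M(G_n)^{2/v(G_n)}}{d_n}\;\le\;\frac{\alpha}{e}.$$ -/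

import Mathlib

open Filter Topology MeasureTheory
open scoped NNReal ENNReal Polynomial

namespace SimpleGraph

/-- `(G, d)` is an admissible pair: `d ≥ 1` is real and all degrees of `G` are at most `d`. -/
def IsAdmissible {V : Type*} [Fintype V] (G : SimpleGraph V) [DecidableRel G.Adj] (d : ℝ) :
    Prop :=
  1 ≤ d ∧ ∀ v, (G.degree v : ℝ) ≤ d

/-- The homomorphism density `hom(F, G) / (v(G) d ^ (v(F) - 1))` of a connected graph `F`. -/
noncomputable def homDensity {U V : Type*} [Fintype U] [Fintype V]
    (F : SimpleGraph U) (G : SimpleGraph V) (d : ℝ) : ℝ :=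
  (Nat.card (F →g G) : ℝ) / ((Fintype.card V : ℝ) * d ^ (Fintype.card U - 1))

/-- `m_k(G)`: the number of matchings of `G` consisting of exactly `k` edges. -/
noncomputable def numMatchings {V : Type*} (G : SimpleGraph V) (k : ℕ) : ℕ :=
  Nat.card {M : G.Subgraph // M.IsMatching ∧ M.edgeSet.ncard = k}

/-- `𝕄(G)`: the number of all matchings of `G`. -/
noncomputable def totalMatchings {V : Type*} [Fintype V] (G : SimpleGraph V) : ℕ :=
  ∑ k ∈ Finset.range (Fintype.card V / 2 + 1), G.numMatchings k

/-- The matching polynomial `∑ k ≤ v(G) / 2, (-1) ^ k m_k(G) x ^ (v(G) - 2 k)`. -/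
noncomputable def matchingPoly {V : Type*} [Fintype V] (G : SimpleGraph V) : ℝ[X] :=
  ∑ k ∈ Finset.range (Fintype.card V / 2 + 1),
    Polynomial.C ((-1 : ℝ) ^ k * (G.numMatchings k : ℝ)) *
      Polynomial.X ^ (Fintype.card V - 2 * k)

/-- The matching measure of `(G, d)`: mass `1 / v(G)` is put at `r / √d` for every root `r` of the
matching polynomial, with multiplicity. The polynomial has degree `v(G)`, so this has total mass
one exactly when all of its complex roots are real (as they are, by Heilmann and Lieb). -/
noncomputable def matchingMeasure {V : Type*} [Fintype V] (G : SimpleGraph V) (d : ℝ) :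
    Measure ℝ :=
  (Fintype.card V : ℝ≥0∞)⁻¹ •
    (G.matchingPoly.roots.map fun r => Measure.dirac (r / √d)).sum

instance isFiniteMeasure_matchingMeasure {V : Type*} [Fintype V] [Nonempty V]
    (G : SimpleGraph V) (d : ℝ) : IsFiniteMeasure (G.matchingMeasure d) := by
  have h : ∀ s : Multiset ℝ,
      IsFiniteMeasure (s.map fun r => Measure.dirac (r / √d)).sum := by
    intro s
    induction s using Multiset.induction with
    | empty => simp only [Multiset.map_zero, Multiset.sum_zero]; infer_instance
    | cons a s ih => simp only [Multiset.map_cons, Multiset.sum_cons]; infer_instance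
  have := h G.matchingPoly.roots
  exact Measure.smul_finite _ (by simp)

/-- The matching measure, as a point of the space of finite measures on `ℝ` with the topology of
weak convergence. -/
noncomputable def matchingFiniteMeasure {V : Type*} [Fintype V] [Nonempty V]
    (G : SimpleGraph V) (d : ℝ) : FiniteMeasure ℝ :=
  ⟨G.matchingMeasure d, inferInstance⟩

end SimpleGraph

/-- The sequence of graphs `G n` with degree bounds `d n` is `α`-regular: the degree of a uniform
random vertex of `G n`, divided by `d n`, tends to `α` in probability. -/
def IsAsympRegular {V : ℕ → Type*} [∀ n, Fintype (V n)] (G : ∀ n, SimpleGraph (V n))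
    [∀ n, DecidableRel (G n).Adj] (d : ℕ → ℝ) (α : ℝ) : Prop :=
  ∀ ε : ℝ, 0 < ε →
    Tendsto (fun n => (Nat.card {v : V n // ε ≤ |((G n).degree v : ℝ) / d n - α|} : ℝ) /
      (Fintype.card (V n) : ℝ)) atTop (𝓝 0)

/-- `t(F, G n, d n)` converges for every finite tree `F`. -/
def TreeDensitiesConverge {V : ℕ → Type*} [∀ n, Fintype (V n)] (G : ∀ n, SimpleGraph (V n))
    (d : ℕ → ℝ) : Prop :=
  ∀ (k : ℕ) (F : SimpleGraph (Fin k)), F.IsTree →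
    ∃ t : ℝ, Tendsto (fun n => F.homDensity (G n) (d n)) atTop (𝓝 t)

/-- Wigner's semicircle density; `Real.sqrt` vanishes at negative reals, so this is zero outside
of `[-2, 2]`. -/
noncomputable def semicircleDensity (x : ℝ) : ℝ :=
  √(4 - x ^ 2) / (2 * Real.pi)

/-- The law of a random variable with Wigner's semicircle density. -/
noncomputable def wignerMeasure : Measure ℝ :=
  volume.withDensity fun x => ENNReal.ofReal (semicircleDensity x)

theorem continuous_semicircleDensity : Continuous semicircleDensity := by
  unfold semicircleDensity
  fun_prop

theorem semicircleDensity_nonneg (x : ℝ) : 0 ≤ semicircleDensity x := by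
  unfold semicircleDensity
  positivity

theorem semicircleDensity_eq_zero {x : ℝ} (hx : x ∉ Set.Ioc (-2 : ℝ) 2) :
    semicircleDensity x = 0 := by
  have h : 4 - x ^ 2 ≤ 0 := by
    by_contra! h
    exact hx ⟨by nlinarith, by nlinarith⟩
  simp [semicircleDensity, Real.sqrt_eq_zero_of_nonpos h]

theorem integral_semicircleDensity : ∫ x in (-2 : ℝ)..2, semicircleDensity x = 1 := by
  have h : ∀ x : ℝ, semicircleDensity x = Real.pi⁻¹ * √(1 - (x / 2) ^ 2) := by
    intro x
    have h4 : 4 - x ^ 2 = 2 ^ 2 * (1 - (x / 2) ^ 2) := by ring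
    unfold semicircleDensity
    rw [h4, Real.sqrt_mul (by positivity), Real.sqrt_sq (by norm_num)]
    field_simp
  simp only [h]
  rw [intervalIntegral.integral_const_mul,
    intervalIntegral.integral_comp_div (fun y => √(1 - y ^ 2)) (by norm_num : (2 : ℝ) ≠ 0)]
  have h1 : (-2 : ℝ) / 2 = -1 := by norm_num
  have h2 : (2 : ℝ) / 2 = 1 := by norm_num
  rw [h1, h2, integral_sqrt_one_sub_sq, smul_eq_mul]
  have := Real.pi_ne_zero
  field_simp

instance isProbabilityMeasure_wignerMeasure : IsProbabilityMeasure wignerMeasure := by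
  constructor
  have hint : ∫⁻ x in Set.Ioc (-2 : ℝ) 2, ENNReal.ofReal (semicircleDensity x) = 1 := by
    rw [← ofReal_integral_eq_lintegral_ofReal
      (continuous_semicircleDensity.integrableOn_Ioc)
      (Eventually.of_forall semicircleDensity_nonneg),
      ← intervalIntegral.integral_of_le (by norm_num), integral_semicircleDensity,
      ENNReal.ofReal_one]
  rw [wignerMeasure, withDensity_apply _ MeasurableSet.univ, Measure.restrict_univ, ← hint,
    ← lintegral_indicator measurableSet_Ioc]
  congr 1 with x
  by_cases hx : x ∈ Set.Ioc (-2 : ℝ) 2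
  · rw [Set.indicator_of_mem hx]
  · rw [Set.indicator_of_notMem hx, semicircleDensity_eq_zero hx, ENNReal.ofReal_zero]

/-- The semicircle distribution on `[-2 β, 2 β]`: the law of `β X`, where `X` has Wigner's
semicircle density (for `β = 0` this is the point mass at `0`). -/
noncomputable def semicircleLaw (β : ℝ) : ProbabilityMeasure ℝ :=
  ⟨wignerMeasure.map fun x => β * x,
    Measure.isProbabilityMeasure_map (measurable_const_mul β).aemeasurable⟩

/-- The integral of an extended-real function, as the integral of its positive part minus the
integral of its negative part. It is used below only where the positive part has a finite integral;
its value may then be `-∞`. -/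
noncomputable def extendedIntegral (μ : Measure ℝ) (f : ℝ → EReal) : EReal :=
  ((∫⁻ x, (f x).toENNReal ∂μ : ℝ≥0∞) : EReal) - ((∫⁻ x, (-f x).toENNReal ∂μ : ℝ≥0∞) : EReal)

/-- `log |x|` as an extended real number, equal to `-∞` at `x = 0`. -/
noncomputable def extendedLogAbs (x : ℝ) : EReal :=
  ENNReal.log (ENNReal.ofReal |x|)

/-!
The matching polynomial satisfies the vertex recursion `μ(S) = x μ(S \ u) - ∑ v ∼ u, μ(S \ {u, v})`.
By induction on `S`, the quotient `μ(S) / μ(S \ u)` has positive imaginary part for `x` in the upper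
half plane, so all roots are real, and is at least `√d` for real `x ≥ 2 √d`, so all roots lie in
`[-2 √d, 2 √d]` (Heilmann and Lieb).

The power sums of the roots are the coefficients of `∑ u, μ(G \ u) / μ(G)`, the logarithmic
derivative of `μ(G)`. By the recursion, this counts closed walks in Godsil's path trees, in which a
walk never meets a vertex of its own path again. After scaling by `√d`, lifting this restriction
costs only `O(1 / d)`, so the moments of `ρ_n` are asymptotically averages over the vertices of
quantities that count trees explored by a walk. These are linear combinations of tree homomorphism
densities, hence converge in (a); when almost all degrees are close to `α d`, they tend to the
moments of the semicircle distribution. On a compact interval moments determine weak limits.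

At `x = i` all terms of the matching polynomial have the same argument, so
`𝕄(G) ^ 2 = ∏ (1 + λ ^ 2)` and `log (𝕄(G) ^ (2 / v(G)) / d) = ∫ log (1 / d + x ^ 2) dρ`. Replacing
`1 / d` by a fixed `ε`, then letting `n → ∞` and `ε → 0`, gives the bound in (a). For the semicircle
distribution on `[-2, 2]` the integral of `log |x|` is `-1 / 2`, which gives `α / e` in (b).
-/

namespace MatchingMeasure

section Matchings

variable {V : Type*} [Fintype V] (G : SimpleGraph V)

open scoped Classical in
/-- The matchings of `G` all of whose vertices lie in `S`, encoded as sets of edges. Deleting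
vertices from `S` replaces deleting vertices from the graph. -/
noncomputable def matchingsIn (S : Finset V) : Finset (Finset (Sym2 V)) :=
  {M | (∀ e ∈ M, e ∈ G.edgeSet ∧ ∀ v ∈ e, v ∈ S) ∧ ∀ e ∈ M, ∀ f ∈ M, ∀ v ∈ e, v ∈ f → e = f}

variable {G} {S : Finset V} {M : Finset (Sym2 V)} {u v : V}

theorem mem_matchingsIn :
    M ∈ matchingsIn G S ↔ (∀ e ∈ M, e ∈ G.edgeSet ∧ ∀ v ∈ e, v ∈ S) ∧
      ∀ e ∈ M, ∀ f ∈ M, ∀ v ∈ e, v ∈ f → e = f := by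
  simp [matchingsIn]

variable [DecidableEq V]

theorem mem_matchingsIn_erase :
    M ∈ matchingsIn G (S.erase u) ↔ M ∈ matchingsIn G S ∧ ∀ e ∈ M, u ∉ e := by
  simp only [mem_matchingsIn, Finset.mem_erase]
  grind

theorem card_filter_exists_mem_edge (hM : M ∈ matchingsIn G S) :
    {v ∈ S | ∃ e ∈ M, v ∈ e}.card = 2 * M.card := by
  obtain ⟨hedge, hdisj⟩ := mem_matchingsIn.1 hM
  have hcover : {v ∈ S | ∃ e ∈ M, v ∈ e} = M.biUnion Sym2.toFinset := by
    ext v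
    simp only [Finset.mem_filter, Finset.mem_biUnion, Sym2.mem_toFinset, and_iff_right_iff_imp]
    rintro ⟨e, he, hv⟩
    exact (hedge e he).2 v hv
  rw [hcover, Finset.card_biUnion, Finset.sum_const_nat, mul_comm]
  · exact fun e he => Sym2.card_toFinset_of_not_isDiag e
      (G.not_isDiag_of_mem_edgeSet (hedge e he).1)
  · intro e he f hf hne
    rw [Function.onFun, Finset.disjoint_left]
    simp only [Sym2.mem_toFinset]
    exact fun v hve hvf => hne (hdisj e he f hf v hve hvf)

omit [DecidableEq V] in
theorem two_mul_card_le (hM : M ∈ matchingsIn G S) : 2 * M.card ≤ S.card := by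
  classical
  exact card_filter_exists_mem_edge hM ▸ Finset.card_filter_le _ _

theorem erase_edge_mem_matchingsIn (hM : M ∈ matchingsIn G S) (he : s(u, v) ∈ M) :
    M.erase s(u, v) ∈ matchingsIn G ((S.erase u).erase v) := by
  simp only [mem_matchingsIn, Finset.mem_erase] at hM ⊢
  have : ∀ f ∈ M, f ≠ s(u, v) → ∀ w ∈ s(u, v), w ∉ f := fun f hf hne w hw hwf =>
    hne (hM.2 f hf _ he w hwf hw)
  have := Sym2.mem_mk_left u v
  have := Sym2.mem_mk_right u v
  grind

theorem edge_notMem_of_mem_matchingsIn_erase (hM : M ∈ matchingsIn G ((S.erase u).erase v)) :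
    s(u, v) ∉ M := fun he =>
  (mem_matchingsIn_erase.1 hM).2 _ he (Sym2.mem_mk_right u v)

theorem insert_edge_mem_matchingsIn (hu : u ∈ S) (hv : v ∈ S) (huv : G.Adj u v)
    (hM : M ∈ matchingsIn G ((S.erase u).erase v)) : insert s(u, v) M ∈ matchingsIn G S := by
  rw [mem_matchingsIn_erase, mem_matchingsIn_erase, mem_matchingsIn] at hM
  simp only [mem_matchingsIn, Finset.mem_insert]
  have : s(u, v) ∈ G.edgeSet := huv
  have : ∀ w ∈ s(u, v), w = u ∨ w = v := fun w => Sym2.mem_iff.1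
  grind

theorem sum_matchingsIn_filter_edge_mem {A : Type*} [AddCommMonoid A] (hu : u ∈ S) (hv : v ∈ S)
    (huv : G.Adj u v) (f : Finset (Sym2 V) → A) :
    ∑ M ∈ matchingsIn G S with s(u, v) ∈ M, f M =
      ∑ M ∈ matchingsIn G ((S.erase u).erase v), f (insert s(u, v) M) := by
  refine Finset.sum_bij' (fun M _ => M.erase s(u, v)) (fun M _ => insert s(u, v) M)
    (fun M hM => ?_) (fun M hM => ?_) (fun M hM => ?_) (fun M hM => ?_) (fun M hM => ?_)
  · exact erase_edge_mem_matchingsIn (Finset.mem_filter.1 hM).1 (Finset.mem_filter.1 hM).2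
  · exact Finset.mem_filter.2
      ⟨insert_edge_mem_matchingsIn hu hv huv hM, Finset.mem_insert_self _ _⟩
  · exact Finset.insert_erase (Finset.mem_filter.1 hM).2
  · exact Finset.erase_insert (edge_notMem_of_mem_matchingsIn_erase hM)
  · rw [Finset.insert_erase (Finset.mem_filter.1 hM).2]

variable [DecidableRel G.Adj]

theorem filter_exists_mem_edge_eq_biUnion :
    {M ∈ matchingsIn G S | ∃ e ∈ M, u ∈ e} =
      {v ∈ S.erase u | G.Adj u v}.biUnion fun v => {M ∈ matchingsIn G S | s(u, v) ∈ M} := by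
  ext M
  simp only [Finset.mem_filter, Finset.mem_biUnion, Finset.mem_erase]
  constructor
  · rintro ⟨hM, e, he, v, rfl⟩
    have hedge := (mem_matchingsIn.1 hM).1 _ he
    have huv : G.Adj u v := hedge.1
    exact ⟨v, ⟨⟨huv.ne', hedge.2 v (Sym2.mem_mk_right u v)⟩, huv⟩, hM, he⟩
  · rintro ⟨v, -, hM, he⟩
    exact ⟨hM, _, he, Sym2.mem_mk_left u v⟩

theorem sum_matchingsIn_eq {A : Type*} [AddCommMonoid A] (hu : u ∈ S)
    (f : Finset (Sym2 V) → A) :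
    ∑ M ∈ matchingsIn G S, f M = ∑ M ∈ matchingsIn G (S.erase u), f M +
      ∑ v ∈ S.erase u with G.Adj u v,
        ∑ M ∈ matchingsIn G ((S.erase u).erase v), f (insert s(u, v) M) := by
  have huncovered : matchingsIn G (S.erase u) = {M ∈ matchingsIn G S | ¬∃ e ∈ M, u ∈ e} := by
    ext M
    simp [mem_matchingsIn_erase]
  rw [← Finset.sum_filter_not_add_sum_filter _ (fun M => ∃ e ∈ M, u ∈ e), huncovered,
    filter_exists_mem_edge_eq_biUnion, Finset.sum_biUnion]
  · refine congrArg _ (Finset.sum_congr rfl fun v hv => ?_)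
    obtain ⟨hv, huv⟩ := Finset.mem_filter.1 hv
    exact sum_matchingsIn_filter_edge_mem hu (Finset.mem_of_mem_erase hv) huv f
  · intro v _ w _ hvw
    rw [Function.onFun, Finset.disjoint_left]
    simp only [Finset.mem_filter, not_and, and_imp]
    exact fun M hM hv _ hw => hvw <| Sym2.congr_right.1 <|
      (mem_matchingsIn.1 hM).2 _ hv _ hw u (Sym2.mem_mk_left u v) (Sym2.mem_mk_left u w)

end Matchings

section MatchingSum

variable {V : Type*} [Fintype V] (G : SimpleGraph V) {A : Type*} [CommRing A] (x y : A)
  (S : Finset V)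

/-- The homogeneous matching polynomial of the subgraph of `G` induced by `S`, in which uncovered
vertices have weight `x` and edges have weight `y`. -/
noncomputable def matchingSum : A :=
  ∑ M ∈ matchingsIn G S, x ^ (S.card - 2 * M.card) * y ^ M.card

@[simp]
theorem matchingSum_empty : matchingSum G x y ∅ = 1 := by
  classical
  have hcard : ∀ M ∈ matchingsIn G ∅, M.card = 0 := fun M hM => by
    simpa using two_mul_card_le hM
  have hmem : matchingsIn G ∅ = {∅} :=
    Finset.eq_singleton_iff_unique_mem.2
      ⟨by simp [mem_matchingsIn], fun M hM => Finset.card_eq_zero.1 (hcard M hM)⟩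
  simp [matchingSum, hmem]

theorem map_matchingSum {B : Type*} [CommRing B] (f : A →+* B) :
    f (matchingSum G x y S) = matchingSum G (f x) (f y) S := by
  simp [matchingSum]

theorem matchingSum_mul (c : A) :
    matchingSum G (c * x) (c ^ 2 * y) S = c ^ S.card * matchingSum G x y S := by
  classical
  rw [matchingSum, matchingSum, Finset.mul_sum]
  refine Finset.sum_congr rfl fun M hM => ?_
  obtain ⟨k, hk⟩ := Nat.exists_eq_add_of_le (two_mul_card_le hM)
  rw [hk, Nat.add_sub_cancel_left]
  ring

theorem matchingSum_neg : matchingSum G (-x) y S = (-1) ^ S.card * matchingSum G x y S := by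
  simp [← matchingSum_mul]

variable {S} in
theorem matchingSum_eq [DecidableEq V] [DecidableRel G.Adj] {u : V} (hu : u ∈ S) :
    matchingSum G x y S = x * matchingSum G x y (S.erase u) +
      y * ∑ v ∈ S.erase u with G.Adj u v, matchingSum G x y ((S.erase u).erase v) := by
  have hS := Finset.card_erase_add_one hu
  simp only [matchingSum, sum_matchingsIn_eq hu, Finset.mul_sum]
  congr 1
  · refine Finset.sum_congr rfl fun M hM => ?_
    have := two_mul_card_le hM
    rw [show S.card - 2 * M.card = ((S.erase u).card - 2 * M.card) + 1 by lia]
    ring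
  · refine Finset.sum_congr rfl fun v hv => Finset.sum_congr rfl fun M hM => ?_
    have := Finset.card_erase_add_one (Finset.mem_filter.1 hv).1
    rw [Finset.card_insert_of_notMem (edge_notMem_of_mem_matchingsIn_erase hM),
      show S.card - 2 * (M.card + 1) = ((S.erase u).erase v).card - 2 * M.card by lia]
    ring

end MatchingSum

section NumMatchings

theorem eq_of_isMatching_of_edgeSet_eq {V : Type*} {G : SimpleGraph V} {H K : G.Subgraph}
    (hH : H.IsMatching) (hK : K.IsMatching) (h : H.edgeSet = K.edgeSet) : H = K := by
  have hadj : H.Adj = K.Adj := by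
    ext a b
    rw [← SimpleGraph.Subgraph.mem_edgeSet, h, SimpleGraph.Subgraph.mem_edgeSet]
  refine SimpleGraph.Subgraph.ext ?_ hadj
  rw [← hH.support_eq_verts, ← hK.support_eq_verts]
  simp only [SimpleGraph.Subgraph.support, SetRel.dom, hadj]

variable {V : Type*} [Fintype V] (G : SimpleGraph V)

variable {G} in
theorem mem_matchingsIn_univ_iff {M : Finset (Sym2 V)} :
    M ∈ matchingsIn G Finset.univ ↔ ∃ H : G.Subgraph, H.IsMatching ∧ H.edgeSet = M := by
  simp only [mem_matchingsIn, Finset.mem_univ, implies_true, and_true]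
  constructor
  · rintro ⟨hedge, hdisj⟩
    refine ⟨{ verts := {v | ∃ e ∈ M, v ∈ e}
              Adj := fun a b => s(a, b) ∈ M
              adj_sub := fun h => hedge _ h
              edge_vert := fun h => ⟨_, h, Sym2.mem_mk_left _ _⟩
              symm := ⟨fun a b h => by rwa [Sym2.eq_swap]⟩ }, ?_, ?_⟩
    · rintro v ⟨e, he, w, rfl⟩
      exact ⟨w, he, fun z hz => Sym2.congr_right.1 <|
        hdisj _ hz _ he v (Sym2.mem_mk_left v z) (Sym2.mem_mk_left v w)⟩
    · ext ⟨a, b⟩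
      rfl
  · rintro ⟨H, hH, hM⟩
    simp only [← Finset.mem_coe, ← hM]
    refine ⟨fun e he => H.edgeSet_subset he, ?_⟩
    rintro _ he _ hf v ⟨a, rfl⟩ ⟨b, rfl⟩
    exact Sym2.congr_right.2 ((hH (H.edge_vert he)).unique he hf)

theorem numMatchings_eq_card (k : ℕ) :
    G.numMatchings k = {M ∈ matchingsIn G Finset.univ | M.card = k}.card := by
  rw [SimpleGraph.numMatchings, ← Nat.card_eq_finsetCard]
  classical
  refine Nat.card_eq_of_bijective (fun H => ⟨H.1.edgeSet.toFinset, Finset.mem_filter.2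
    ⟨mem_matchingsIn_univ_iff.2 ⟨H.1, H.2.1, by simp⟩, ?_⟩⟩) ⟨?_, ?_⟩
  · rw [← Set.ncard_eq_toFinset_card', H.2.2]
  · rintro ⟨H, hH, _⟩ ⟨K, hK, _⟩ h
    exact Subtype.ext (eq_of_isMatching_of_edgeSet_eq hH hK (by simpa using h))
  · rintro ⟨M, hM⟩
    obtain ⟨hM, hcard⟩ := Finset.mem_filter.1 hM
    obtain ⟨H, hH, hHM⟩ := mem_matchingsIn_univ_iff.1 hM
    exact ⟨⟨H, hH, by rw [hHM, Set.ncard_coe_finset, hcard]⟩, Subtype.ext (by simp [hHM])⟩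

theorem sum_range_numMatchings_nsmul {A : Type*} [AddCommMonoid A] (f : ℕ → A) :
    ∑ k ∈ Finset.range (Fintype.card V / 2 + 1), G.numMatchings k • f k =
      ∑ M ∈ matchingsIn G Finset.univ, f M.card := by
  classical
  rw [← Finset.sum_fiberwise_of_maps_to (t := Finset.range (Fintype.card V / 2 + 1))
    (g := Finset.card)]
  · refine Finset.sum_congr rfl fun k _ => ?_
    rw [numMatchings_eq_card, Finset.sum_congr rfl fun M hM => by rw [(Finset.mem_filter.1 hM).2],
      Finset.sum_const]
  · intro M hM
    have := two_mul_card_le hM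
    rw [Finset.card_univ] at this
    rw [Finset.mem_range]
    lia

theorem matchingPoly_eq_matchingSum :
    G.matchingPoly = matchingSum G Polynomial.X (-1) Finset.univ := by
  rw [matchingSum, ← sum_range_numMatchings_nsmul G
    fun k => (Polynomial.X : ℝ[X]) ^ (Finset.univ.card - 2 * k) * (-1) ^ k,
    SimpleGraph.matchingPoly, Finset.card_univ]
  refine Finset.sum_congr rfl fun k _ => ?_
  simp only [map_mul, map_pow, map_neg, map_one, map_natCast, nsmul_eq_mul]
  ring

theorem natCast_totalMatchings {A : Type*} [CommRing A] :
    (G.totalMatchings : A) = matchingSum G 1 1 Finset.univ := by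
  simp [matchingSum, ← sum_range_numMatchings_nsmul G fun _ => (1 : A),
    SimpleGraph.totalMatchings]

end NumMatchings

section Roots

variable {V : Type*} [Fintype V] (G : SimpleGraph V)

theorem matchingSum_ne_zero_and_im_div_pos [DecidableEq V] {z : ℂ} (hz : 0 < z.im)
    (S : Finset V) :
    matchingSum G z (-1) S ≠ 0 ∧
      ∀ u ∈ S, 0 < (matchingSum G z (-1) S / matchingSum G z (-1) (S.erase u)).im := by
  classical
  induction S using Finset.strongInduction with
  | H S ih =>
    have him : ∀ u ∈ S, 0 < (matchingSum G z (-1) S / matchingSum G z (-1) (S.erase u)).im := by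
      intro u hu
      obtain ⟨h0, hpos⟩ := ih _ (Finset.erase_ssubset hu)
      rw [matchingSum_eq G z (-1) hu, neg_one_mul, ← sub_eq_add_neg, sub_div,
        mul_div_cancel_right₀ _ h0, Finset.sum_div, Complex.sub_im, Complex.im_sum, sub_pos]
      refine lt_of_le_of_lt (Finset.sum_nonpos fun v hv => ?_) hz
      rw [← inv_div, Complex.inv_im]
      exact div_nonpos_of_nonpos_of_nonneg
        (neg_nonpos.2 (hpos v (Finset.mem_filter.1 hv).1).le) (Complex.normSq_nonneg _)
    refine ⟨?_, him⟩
    rcases S.eq_empty_or_nonempty with rfl | ⟨u, hu⟩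
    · simp
    · intro h
      simpa [h] using him u hu

theorem matchingSum_ne_zero_of_im_ne_zero {z : ℂ} (hz : z.im ≠ 0) (S : Finset V) :
    matchingSum G z (-1) S ≠ 0 := by
  classical
  rcases hz.lt_or_gt with h | h
  · intro h0
    exact (matchingSum_ne_zero_and_im_div_pos G (z := -z) (by simpa using h) S).1
      (by rw [matchingSum_neg, h0, mul_zero])
  · exact (matchingSum_ne_zero_and_im_div_pos G h S).1

theorem matchingSum_pos_and_mul_erase_le [DecidableEq V] [DecidableRel G.Adj] {s x : ℝ}
    (hs : 0 < s) (hdeg : ∀ v, (G.degree v : ℝ) ≤ s ^ 2) (hx : 2 * s ≤ x) (S : Finset V) :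
    0 < matchingSum G x (-1) S ∧
      ∀ u ∈ S, s * matchingSum G x (-1) (S.erase u) ≤ matchingSum G x (-1) S := by
  induction S using Finset.strongInduction with
  | H S ih =>
    have hle : ∀ u ∈ S, s * matchingSum G x (-1) (S.erase u) ≤ matchingSum G x (-1) S := by
      intro u hu
      obtain ⟨hpos, hle⟩ := ih _ (Finset.erase_ssubset hu)
      have hcard : ({v ∈ S.erase u | G.Adj u v}.card : ℝ) ≤ s ^ 2 := by
        refine le_trans ?_ (hdeg u)
        rw [← G.card_neighborFinset_eq_degree]
        exact_mod_cast Finset.card_le_card fun v hv => by simpa using (Finset.mem_filter.1 hv).2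
      have hsum : ∑ v ∈ S.erase u with G.Adj u v, matchingSum G x (-1) ((S.erase u).erase v) ≤
          s * matchingSum G x (-1) (S.erase u) := calc
        _ ≤ ∑ v ∈ S.erase u with G.Adj u v, matchingSum G x (-1) (S.erase u) / s :=
          Finset.sum_le_sum fun v hv => by
            rw [le_div_iff₀' hs]
            exact hle v (Finset.mem_filter.1 hv).1
        _ ≤ s ^ 2 * (matchingSum G x (-1) (S.erase u) / s) := by
          rw [Finset.sum_const, nsmul_eq_mul]
          gcongr
        _ = s * matchingSum G x (-1) (S.erase u) := by field_simp
      rw [matchingSum_eq G x (-1) hu]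
      nlinarith
    refine ⟨?_, hle⟩
    rcases S.eq_empty_or_nonempty with rfl | ⟨u, hu⟩
    · simp
    · exact (mul_pos hs (ih _ (Finset.erase_ssubset hu)).1).trans_le (hle u hu)

theorem natDegree_matchingPoly_le : G.matchingPoly.natDegree ≤ Fintype.card V :=
  Polynomial.natDegree_sum_le_of_forall_le _ _ fun _ _ =>
    (Polynomial.natDegree_C_mul_X_pow_le _ _).trans (Nat.sub_le _ _)

theorem coeff_card_matchingPoly : G.matchingPoly.coeff (Fintype.card V) = 1 := by
  classical
  have hM : ∀ M ∈ matchingsIn G Finset.univ, M.card = 0 ↔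
      Fintype.card V = Fintype.card V - 2 * M.card := fun M hM => by
    have := two_mul_card_le hM
    rw [Finset.card_univ] at this
    lia
  rw [matchingPoly_eq_matchingSum, matchingSum, Polynomial.finsetSum_coeff,
    Finset.sum_eq_single_of_mem ∅ (by simp [mem_matchingsIn])]
  · simp
  · intro M hmem hne
    rw [← map_one Polynomial.C, ← map_neg, ← map_pow, Polynomial.coeff_mul_C,
      Polynomial.coeff_X_pow, Finset.card_univ,
      if_neg ((hM M hmem).not.1 (by simpa using hne)), zero_mul]

theorem natDegree_matchingPoly : G.matchingPoly.natDegree = Fintype.card V :=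
  Polynomial.natDegree_eq_of_le_of_coeff_ne_zero (natDegree_matchingPoly_le G)
    (by rw [coeff_card_matchingPoly]; exact one_ne_zero)

theorem monic_matchingPoly : G.matchingPoly.Monic :=
  Polynomial.monic_of_natDegree_le_of_coeff_eq_one _ (natDegree_matchingPoly_le G)
    (coeff_card_matchingPoly G)

theorem eval₂_matchingPoly {A : Type*} [CommRing A] (f : ℝ →+* A) (x : A) :
    G.matchingPoly.eval₂ f x = matchingSum G x (-1) Finset.univ := by
  rw [matchingPoly_eq_matchingSum, ← Polynomial.coe_eval₂RingHom, map_matchingSum]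
  simp

theorem splits_matchingPoly : G.matchingPoly.Splits := by
  refine Polynomial.Splits.of_splits_map Complex.ofRealHom (IsAlgClosed.splits _) fun z hz => ?_
  have hroot : matchingSum G z (-1) Finset.univ = 0 := by
    rw [← eval₂_matchingPoly G Complex.ofRealHom, ← Polynomial.eval_map]
    exact Polynomial.isRoot_of_mem_roots hz
  have him : z.im = 0 := by
    by_contra h
    exact matchingSum_ne_zero_of_im_ne_zero G h _ hroot
  exact ⟨z.re, Complex.ext (by simp) (by simp [him])⟩

theorem card_roots_matchingPoly : G.matchingPoly.roots.card = Fintype.card V := by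
  rw [← (splits_matchingPoly G).natDegree_eq_card_roots, natDegree_matchingPoly]

variable {G} in
theorem abs_le_of_mem_roots_matchingPoly [DecidableRel G.Adj] {s r : ℝ} (hs : 0 < s)
    (hdeg : ∀ v, (G.degree v : ℝ) ≤ s ^ 2) (hr : r ∈ G.matchingPoly.roots) : |r| ≤ 2 * s := by
  classical
  by_contra! h
  have hroot : matchingSum G r (-1) Finset.univ = 0 := by
    rw [← eval₂_matchingPoly G (RingHom.id ℝ)]
    exact Polynomial.isRoot_of_mem_roots hr
  have hpos := (matchingSum_pos_and_mul_erase_le G hs hdeg h.le Finset.univ).1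
  rcases abs_choice r with hr' | hr' <;> rw [hr'] at hpos
  · exact hpos.ne' hroot
  · rw [matchingSum_neg, hroot, mul_zero] at hpos
    exact hpos.false

theorem matchingSum_eq_prod_roots {A : Type*} [CommRing A] [Algebra ℝ A] (x : A) :
    matchingSum G x (-1) Finset.univ =
      (G.matchingPoly.roots.map fun r => x - algebraMap ℝ A r).prod := by
  rw [← eval₂_matchingPoly G (algebraMap ℝ A)]
  conv_lhs => rw [(splits_matchingPoly G).eq_prod_roots_of_monic (monic_matchingPoly G)]
  rw [Polynomial.eval₂_multiset_prod, Multiset.map_map]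
  simp

theorem matchingSum_one_neg_sq_eq_prod_roots {K : Type*} [Field K] [Algebra ℝ K] {t : K}
    (ht : t ≠ 0) :
    matchingSum G 1 (-t ^ 2) Finset.univ =
      (G.matchingPoly.roots.map fun r => 1 - algebraMap ℝ K r * t).prod := by
  have h := matchingSum_mul G t⁻¹ (-1) Finset.univ t
  rw [mul_inv_cancel₀ ht, mul_neg_one, matchingSum_eq_prod_roots, Finset.card_univ,
    ← card_roots_matchingPoly G, ← Multiset.prod_replicate (Multiset.card _),
    ← Multiset.map_const', ← Multiset.prod_map_mul] at h
  rw [h]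
  refine congrArg _ (Multiset.map_congr rfl fun r _ => ?_)
  rw [mul_sub, mul_inv_cancel₀ ht, mul_comm]

/- Evaluate the matching polynomial at the imaginary unit, where all its terms have the same
argument, and take absolute values. -/
theorem totalMatchings_sq :
    (G.totalMatchings : ℝ) ^ 2 = (G.matchingPoly.roots.map fun r => 1 + r ^ 2).prod := by
  have heval : Complex.I ^ (Finset.univ : Finset V).card * (G.totalMatchings : ℂ) =
      (G.matchingPoly.roots.map fun r => Complex.I - algebraMap ℝ ℂ r).prod := by
    rw [← matchingSum_eq_prod_roots, natCast_totalMatchings, ← matchingSum_mul]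
    simp
  have hnorm := congrArg Complex.normSq heval
  rw [map_mul, map_pow, map_multiset_prod, Multiset.map_map, Complex.normSq_I, one_pow, one_mul,
    Complex.normSq_natCast, ← sq] at hnorm
  rw [hnorm]
  refine congrArg _ (Multiset.map_congr rfl fun r _ => ?_)
  simp only [Function.comp_apply, Complex.coe_algebraMap, Complex.normSq_apply, Complex.sub_re,
    Complex.sub_im, Complex.I_re, Complex.I_im, Complex.ofReal_re, Complex.ofReal_im]
  ring

end Roots

section PowerSums

open PowerSeries (X C mk coeff derivative)

theorem prod_one_sub_C_mul_X_mul_sum_mk_pow {R : Type*} [CommRing R] (s : Multiset R) :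
    (s.map fun r => 1 - C r * X).prod * (s.map fun r => mk fun k => r ^ k).sum =
      (s.card : PowerSeries R) * (s.map fun r => 1 - C r * X).prod -
        X * derivative R (s.map fun r => 1 - C r * X).prod := by
  induction s using Multiset.induction with
  | empty => simp
  | cons r s ih =>
    have hgeom : (1 - C r * X) * mk (fun k => r ^ k) = 1 := by
      ext k
      rw [sub_mul, one_mul, map_sub, mul_assoc, PowerSeries.coeff_C_mul]
      rcases k with _ | k
      · simp
      · simp [PowerSeries.coeff_succ_X_mul, PowerSeries.coeff_one, pow_succ']
    simp only [Multiset.map_cons, Multiset.prod_cons, Multiset.sum_cons, Multiset.card_cons]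
    rw [Derivation.leibniz, map_sub, Derivation.leibniz]
    simp only [smul_eq_mul, PowerSeries.derivative_X, PowerSeries.derivative_C,
      Derivation.map_one_eq_zero]
    push_cast
    linear_combination (1 - C r * X) * ih + (s.map fun r => 1 - C r * X).prod * hgeom

variable {V : Type*} [Fintype V] (G : SimpleGraph V)

theorem sum_matchingSum_one_erase [DecidableEq V] {A : Type*} [CommRing A] (y : A)
    (S : Finset V) :
    ∑ u ∈ S, matchingSum G 1 y (S.erase u) =
      ∑ M ∈ matchingsIn G S, (S.card - 2 * M.card : A) * y ^ M.card := by
  have herase : ∀ u, matchingsIn G (S.erase u) =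
      {M ∈ matchingsIn G S | ¬∃ e ∈ M, u ∈ e} := fun u => by
    ext M
    simp [mem_matchingsIn_erase]
  simp only [matchingSum, one_pow, one_mul, herase, Finset.sum_filter]
  rw [Finset.sum_comm]
  refine Finset.sum_congr rfl fun M hM => ?_
  rw [← Finset.sum_filter, Finset.sum_const, nsmul_eq_mul,
    ← Finset.card_filter_add_card_filter_not (s := S) fun u => ∃ e ∈ M, u ∈ e,
    card_filter_exists_mem_edge hM]
  push_cast
  ring

/-- The reversed matching polynomial `∑ (-1) ^ k m_k X ^ (2 k)` of the subgraph of `G` induced by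
`S`, as a power series so that it can be inverted. -/
noncomputable def matchingSeries (S : Finset V) : PowerSeries ℝ :=
  matchingSum G 1 (-X ^ 2) S

theorem matchingSeries_univ :
    matchingSeries G Finset.univ = (G.matchingPoly.roots.map fun r => 1 - C r * X).prod := by
  let φ := algebraMap (PowerSeries ℝ) (FractionRing (PowerSeries ℝ))
  have hφ : Function.Injective φ := IsFractionRing.injective _ _
  apply hφ
  have hX : φ X ≠ 0 := (map_ne_zero_iff φ hφ).2 PowerSeries.X_ne_zero
  rw [matchingSeries, map_matchingSum, map_multiset_prod, Multiset.map_map, map_one, map_neg,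
    map_pow, matchingSum_one_neg_sq_eq_prod_roots G hX]
  refine congrArg _ (Multiset.map_congr rfl fun r _ => ?_)
  simp [φ, IsScalarTower.algebraMap_apply ℝ (PowerSeries ℝ) (FractionRing (PowerSeries ℝ))]

theorem sum_matchingSeries_erase [DecidableEq V] (S : Finset V) :
    ∑ u ∈ S, matchingSeries G (S.erase u) =
      (S.card : PowerSeries ℝ) * matchingSeries G S - X * derivative ℝ (matchingSeries G S) := by
  have hderiv : ∀ k : ℕ, X * derivative ℝ ((-X ^ 2 : PowerSeries ℝ) ^ k) =
      (2 * k : PowerSeries ℝ) * (-X ^ 2) ^ k := fun k => by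
    rcases k with _ | k
    · simp
    · rw [Derivation.leibniz_pow, map_neg, Derivation.leibniz_pow]
      simp only [PowerSeries.derivative_X, smul_eq_mul, nsmul_eq_mul, add_tsub_cancel_right,
        Nat.add_one_sub_one, Nat.cast_add, Nat.cast_one, Nat.cast_ofNat, pow_one]
      ring
  simp only [matchingSeries, sum_matchingSum_one_erase, sub_mul, Finset.sum_sub_distrib,
    ← Finset.mul_sum]
  simp only [matchingSum, one_pow, one_mul, map_sum, Finset.mul_sum, hderiv]

theorem constantCoeff_matchingSeries (S : Finset V) :
    PowerSeries.constantCoeff (matchingSeries G S) = 1 := by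
  rw [matchingSeries, map_matchingSum, matchingSum,
    Finset.sum_eq_single_of_mem ∅ (by simp [mem_matchingsIn])]
  · simp
  · intro M _ hM
    simp [hM]

theorem matchingSeries_mul_inv (S : Finset V) :
    matchingSeries G S * (matchingSeries G S)⁻¹ = 1 :=
  PowerSeries.mul_inv_cancel _ (by simp [constantCoeff_matchingSeries])

/-- The generating function of the closed walks from `u` in Godsil's path tree of the subgraph of
`G` induced by `S`. -/
noncomputable def pathSeries [DecidableEq V] (S : Finset V) (u : V) : PowerSeries ℝ :=
  matchingSeries G (S.erase u) * (matchingSeries G S)⁻¹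

theorem sum_pathSeries_univ [DecidableEq V] :
    ∑ u, pathSeries G Finset.univ u =
      (G.matchingPoly.roots.map fun r => mk fun k => r ^ k).sum := by
  have h := prod_one_sub_C_mul_X_mul_sum_mk_pow G.matchingPoly.roots
  rw [← matchingSeries_univ, card_roots_matchingPoly, ← Finset.card_univ,
    ← sum_matchingSeries_erase] at h
  simp only [pathSeries]
  rw [← Finset.sum_mul, ← h, mul_right_comm, matchingSeries_mul_inv, one_mul]

theorem sum_pow_roots_matchingPoly [DecidableEq V] (k : ℕ) :
    (G.matchingPoly.roots.map fun r => r ^ k).sum =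
      ∑ u, coeff k (pathSeries G Finset.univ u) := by
  rw [← map_sum, sum_pathSeries_univ, map_multiset_sum, Multiset.map_map]
  simp

variable [DecidableEq V] {S : Finset V} {u : V} (hu : u ∈ S)

include hu

theorem pathSeries_eq [DecidableRel G.Adj] :
    pathSeries G S u = 1 + X ^ 2 * (pathSeries G S u *
      ∑ v ∈ S.erase u with G.Adj u v, pathSeries G (S.erase u) v) := by
  simp only [pathSeries]
  rw [← Finset.sum_mul]
  have hrec := matchingSum_eq G (1 : PowerSeries ℝ) (-X ^ 2) hu
  simp only [← matchingSeries.eq_1] at hrec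
  linear_combination (-(matchingSeries G S)⁻¹) * hrec + matchingSeries_mul_inv G S -
    X ^ 2 * (matchingSeries G S)⁻¹ *
      (∑ v ∈ S.erase u with G.Adj u v, matchingSeries G ((S.erase u).erase v)) *
      matchingSeries_mul_inv G (S.erase u)

theorem coeff_zero_pathSeries : coeff 0 (pathSeries G S u) = 1 := by
  classical
  rw [pathSeries_eq G hu]
  simp

theorem coeff_one_pathSeries : coeff 1 (pathSeries G S u) = 0 := by
  classical
  rw [pathSeries_eq G hu]
  simp [PowerSeries.coeff_X_pow_mul', PowerSeries.coeff_one]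

theorem coeff_add_two_pathSeries [DecidableRel G.Adj] (k : ℕ) :
    coeff (k + 2) (pathSeries G S u) =
      ∑ p ∈ Finset.HasAntidiagonal.antidiagonal k, coeff p.1 (pathSeries G S u) *
        ∑ v ∈ S.erase u with G.Adj u v, coeff p.2 (pathSeries G (S.erase u) v) := by
  conv_lhs => rw [pathSeries_eq G hu]
  rw [map_add, PowerSeries.coeff_X_pow_mul, PowerSeries.coeff_mul, PowerSeries.coeff_one]
  simp

end PowerSums

/-- The moments of the semicircle distribution on `[-2, 2]`, through the Catalan recursion. -/
noncomputable def semicircleMoment : ℕ → ℝ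
  | 0 => 1
  | 1 => 0
  | k + 2 => ∑ i : Fin (k + 1), semicircleMoment i * semicircleMoment (k - i)

theorem semicircleMoment_nonneg (k : ℕ) : 0 ≤ semicircleMoment k := by
  induction k using Nat.strong_induction_on with
  | _ k ih =>
    match k with
    | 0 => simp [semicircleMoment]
    | 1 => simp [semicircleMoment]
    | k + 2 =>
      rw [semicircleMoment]
      exact Finset.sum_nonneg fun i _ => mul_nonneg (ih _ (by omega)) (ih _ (by omega))

/-- The normalized number of closed walks of length `k` from `u` that explore a tree-like shape:
the coefficients of the solution of `B u = 1 + t ^ 2 * B u * (∑ v ∈ N(u), B v) / d`. -/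
noncomputable def branchCoeff {V : Type*} [Fintype V] (G : SimpleGraph V) [DecidableRel G.Adj]
    (d : ℝ) : ℕ → V → ℝ
  | 0, _ => 1
  | 1, _ => 0
  | k + 2, u => ∑ i : Fin (k + 1), branchCoeff G d i u *
      ((∑ v ∈ G.neighborFinset u, branchCoeff G d (k - i) v) / d)

/-- The normalized coefficients of `pathSeries`; they differ from `branchCoeff` in that the vertices
passed on the way down the tree are removed from the graph. -/
noncomputable def pathCoeff {V : Type*} [Fintype V] [DecidableEq V] (G : SimpleGraph V) (d : ℝ)
    (k : ℕ) (S : Finset V) (u : V) : ℝ :=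
  PowerSeries.coeff k (pathSeries G S u) / √d ^ k

/-- `deletionError k s / d` bounds the difference between `pathCoeff` and `branchCoeff` in degree
`k` when at most `s` vertices have been removed. -/
noncomputable def deletionError : ℕ → ℕ → ℝ
  | 0, _ => 0
  | 1, _ => 0
  | k + 2, s => ∑ i : Fin (k + 1), (deletionError i s * semicircleMoment (k - i) +
      semicircleMoment i * (deletionError (k - i) (s + 1) + s * semicircleMoment (k - i)))

theorem deletionError_nonneg (k s : ℕ) : 0 ≤ deletionError k s := by
  induction k using Nat.strong_induction_on generalizing s with
  | _ k ih =>
    match k with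
    | 0 => simp [deletionError]
    | 1 => simp [deletionError]
    | k + 2 =>
      rw [deletionError]
      refine Finset.sum_nonneg fun i _ => ?_
      have := ih i (by omega) s
      have := ih (k - i) (by omega) (s + 1)
      have := semicircleMoment_nonneg i
      have := semicircleMoment_nonneg (k - i)
      positivity

theorem abs_mul_sub_mul_le {a b a' b' A B δ ε : ℝ} (ha : |a - a'| ≤ δ) (hb : |b - b'| ≤ ε)
    (ha' : |a'| ≤ A) (hb' : |b| ≤ B) : |a * b - a' * b'| ≤ δ * B + A * ε := by
  calc |a * b - a' * b'| = |(a - a') * b + a' * (b - b')| := by ring_nf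
    _ ≤ |a - a'| * |b| + |a'| * |b - b'| := by
      rw [← abs_mul, ← abs_mul]
      exact abs_add_le _ _
    _ ≤ δ * B + A * ε :=
      add_le_add (mul_le_mul ha hb' (abs_nonneg _) ((abs_nonneg _).trans ha))
        (mul_le_mul ha' hb (abs_nonneg _) ((abs_nonneg _).trans ha'))

theorem sqrt_pow_add_two {x : ℝ} (hx : 0 ≤ x) {i k : ℕ} (hik : i ≤ k) :
    √x ^ (k + 2) = √x ^ i * √x ^ (k - i) * x := by
  rw [← pow_add, Nat.add_sub_cancel' hik, pow_add, Real.sq_sqrt hx]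

section Admissible

variable {V : Type*} [Fintype V] {G : SimpleGraph V} [DecidableRel G.Adj] {d : ℝ}

theorem pos_of_isAdmissible (hd : G.IsAdmissible d) : 0 < d := zero_lt_one.trans_le hd.1

theorem sum_le_mul_of_subset_neighborFinset (hd : G.IsAdmissible d) {u : V} {T : Finset V}
    (hT : T ⊆ G.neighborFinset u) {f : V → ℝ} {B : ℝ} (hf : ∀ v ∈ T, f v ≤ B) (hB : 0 ≤ B) :
    ∑ v ∈ T, f v ≤ d * B := by
  have hcard : (T.card : ℝ) ≤ d := by
    refine le_trans ?_ (hd.2 u)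
    rw [← G.card_neighborFinset_eq_degree]
    exact_mod_cast Finset.card_le_card hT
  calc ∑ v ∈ T, f v ≤ T.card • B := Finset.sum_le_card_nsmul T f B hf
    _ ≤ d * B := by
      rw [nsmul_eq_mul]
      gcongr

theorem sum_div_mem_Icc (hd : G.IsAdmissible d) {u : V} {T : Finset V}
    (hT : T ⊆ G.neighborFinset u) {f : V → ℝ} {B : ℝ} (hf : ∀ v ∈ T, f v ∈ Set.Icc 0 B)
    (hB : 0 ≤ B) : (∑ v ∈ T, f v) / d ∈ Set.Icc 0 B := by
  have hd0 := pos_of_isAdmissible hd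
  refine ⟨div_nonneg (Finset.sum_nonneg fun v hv => (hf v hv).1) hd0.le, ?_⟩
  rw [div_le_iff₀' hd0]
  exact sum_le_mul_of_subset_neighborFinset hd hT (fun v hv => (hf v hv).2) hB

theorem branchCoeff_mem_Icc (hd : G.IsAdmissible d) (k : ℕ) (u : V) :
    branchCoeff G d k u ∈ Set.Icc 0 (semicircleMoment k) := by
  induction k using Nat.strong_induction_on generalizing u with
  | _ k ih =>
    match k with
    | 0 => simp [semicircleMoment, branchCoeff]
    | 1 => simp [semicircleMoment, branchCoeff]
    | k + 2 =>
      rw [semicircleMoment, branchCoeff]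
      have hroot (i : Fin (k + 1)) := ih i (by omega) u
      have hchild (i : Fin (k + 1)) := sum_div_mem_Icc hd (subset_refl (G.neighborFinset u))
        (fun v _ => ih (k - i) (by omega) v) (semicircleMoment_nonneg _)
      exact ⟨Finset.sum_nonneg fun i _ => mul_nonneg (hroot i).1 (hchild i).1,
        Finset.sum_le_sum fun i _ => mul_le_mul (hroot i).2 (hchild i).2 (hchild i).1
          (semicircleMoment_nonneg _)⟩

theorem abs_sum_sub_sum_neighborFinset_div_le [DecidableEq V] (hd : G.IsAdmissible d) {u : V}
    {T : Finset V} (hT : T ⊆ G.neighborFinset u) {f g : V → ℝ} {B E : ℝ} {s : ℕ} (hE : 0 ≤ E)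
    (hB : 0 ≤ B) (hfg : ∀ v ∈ T, |f v - g v| ≤ E) (hg : ∀ v, |g v| ≤ B)
    (hs : (G.neighborFinset u \ T).card ≤ s) :
    |(∑ v ∈ T, f v) / d - (∑ v ∈ G.neighborFinset u, g v) / d| ≤ E + s * B / d := by
  have hd0 := pos_of_isAdmissible hd
  have hkept : |∑ v ∈ T, f v - ∑ v ∈ T, g v| ≤ d * E := by
    rw [← Finset.sum_sub_distrib]
    exact (Finset.abs_sum_le_sum_abs _ _).trans
      (sum_le_mul_of_subset_neighborFinset hd hT hfg hE)
  have hlost : |∑ v ∈ G.neighborFinset u \ T, g v| ≤ s * B :=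
    calc |∑ v ∈ G.neighborFinset u \ T, g v| ≤ ∑ v ∈ G.neighborFinset u \ T, |g v| :=
          Finset.abs_sum_le_sum_abs _ _
      _ ≤ (G.neighborFinset u \ T).card • B := Finset.sum_le_card_nsmul _ _ _ fun v _ => hg v
      _ ≤ s * B := by
        rw [nsmul_eq_mul]
        gcongr
  rw [← Finset.sum_sdiff hT, ← sub_div, abs_div, abs_of_pos hd0, div_le_iff₀ hd0,
    show (E + s * B / d) * d = d * E + s * B by field_simp, ← sub_sub, sub_right_comm]
  exact (abs_sub _ _).trans (add_le_add hkept hlost)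

variable {S : Finset V} {u : V}

theorem filter_adj_subset_neighborFinset : {v ∈ S | G.Adj u v} ⊆ G.neighborFinset u := by
  simp [Finset.subset_iff]

variable [DecidableEq V]

theorem pathCoeff_add_two (hd : 0 < d) (hu : u ∈ S) (k : ℕ) :
    pathCoeff G d (k + 2) S u = ∑ i : Fin (k + 1), pathCoeff G d i S u *
      ((∑ v ∈ S.erase u with G.Adj u v, pathCoeff G d (k - i) (S.erase u) v) / d) := by
  have := Real.sqrt_pos.2 hd
  simp only [pathCoeff]
  rw [coeff_add_two_pathSeries G hu, Finset.Nat.sum_antidiagonal_eq_sum_range_succ_mk,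
    Finset.sum_range, Finset.sum_div]
  refine Finset.sum_congr rfl fun i _ => ?_
  rw [← Finset.sum_div, sqrt_pow_add_two hd.le (Nat.le_of_lt_succ i.2)]
  field_simp

theorem pathCoeff_mem_Icc (hd : G.IsAdmissible d) (k : ℕ) (hu : u ∈ S) :
    pathCoeff G d k S u ∈ Set.Icc 0 (semicircleMoment k) := by
  induction k using Nat.strong_induction_on generalizing S u with
  | _ k ih =>
    match k with
    | 0 => simp [semicircleMoment, pathCoeff, coeff_zero_pathSeries G hu]
    | 1 => simp [semicircleMoment, pathCoeff, coeff_one_pathSeries G hu]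
    | k + 2 =>
      rw [semicircleMoment, pathCoeff_add_two (pos_of_isAdmissible hd) hu]
      have hroot (i : Fin (k + 1)) := ih i (by omega) hu
      have hchild (i : Fin (k + 1)) := sum_div_mem_Icc hd
        (filter_adj_subset_neighborFinset (S := S.erase u) (u := u))
        (fun v hv => ih (k - i) (by omega) (Finset.mem_filter.1 hv).1) (semicircleMoment_nonneg _)
      exact ⟨Finset.sum_nonneg fun i _ => mul_nonneg (hroot i).1 (hchild i).1,
        Finset.sum_le_sum fun i _ => mul_le_mul (hroot i).2 (hchild i).2 (hchild i).1
          (semicircleMoment_nonneg _)⟩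

theorem card_compl_erase_le {s : ℕ} (hs : Sᶜ.card ≤ s) : (S.erase u)ᶜ.card ≤ s + 1 := by
  rw [Finset.compl_erase]
  exact (Finset.card_insert_le _ _).trans (Nat.succ_le_succ hs)

theorem card_neighborFinset_sdiff_le {s : ℕ} (hs : Sᶜ.card ≤ s) :
    (G.neighborFinset u \ {v ∈ S.erase u | G.Adj u v}).card ≤ s := by
  refine (Finset.card_le_card fun v => ?_).trans hs
  simp only [Finset.mem_sdiff, SimpleGraph.mem_neighborFinset, Finset.mem_filter,
    Finset.mem_erase, Finset.mem_compl]
  exact fun ⟨hadj, hv⟩ hvS => hv ⟨⟨hadj.ne', hvS⟩, hadj⟩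

theorem abs_pathCoeff_sub_branchCoeff_le (hd : G.IsAdmissible d) (k s : ℕ) (hu : u ∈ S)
    (hs : Sᶜ.card ≤ s) :
    |pathCoeff G d k S u - branchCoeff G d k u| ≤ deletionError k s / d := by
  induction k using Nat.strong_induction_on generalizing s S u with
  | _ k ih =>
    match k with
    | 0 => simp [branchCoeff, pathCoeff, deletionError, coeff_zero_pathSeries G hu]
    | 1 => simp [branchCoeff, pathCoeff, deletionError, coeff_one_pathSeries G hu]
    | k + 2 =>
      have hd0 := pos_of_isAdmissible hd
      have abs_le_of_mem {x B : ℝ} (hx : x ∈ Set.Icc 0 B) : |x| ≤ B :=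
        (abs_of_nonneg hx.1).trans_le hx.2
      rw [pathCoeff_add_two hd0 hu, branchCoeff, deletionError, ← Finset.sum_sub_distrib,
        Finset.sum_div]
      refine (Finset.abs_sum_le_sum_abs _ _).trans (Finset.sum_le_sum fun i _ => ?_)
      have hchildren := abs_sum_sub_sum_neighborFinset_div_le hd
        (filter_adj_subset_neighborFinset (S := S.erase u) (u := u))
        (div_nonneg (deletionError_nonneg (k - i) (s + 1)) hd0.le)
        (semicircleMoment_nonneg (k - i))
        (fun v hv => ih (k - i) (by omega) (s + 1) (Finset.mem_filter.1 hv).1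
          (card_compl_erase_le hs))
        (fun v => abs_le_of_mem (branchCoeff_mem_Icc hd (k - i) v))
        (card_neighborFinset_sdiff_le hs)
      have hbound := sum_div_mem_Icc hd
        (filter_adj_subset_neighborFinset (S := S.erase u) (u := u))
        (fun v hv => pathCoeff_mem_Icc hd (k - i) (Finset.mem_filter.1 hv).1)
        (semicircleMoment_nonneg _)
      refine (abs_mul_sub_mul_le (ih i (by omega) s hu hs) hchildren
        (abs_le_of_mem (branchCoeff_mem_Icc hd i u)) (abs_le_of_mem hbound)).trans_eq ?_
      ring

end Admissible

theorem abs_average_pow_roots_sub_average_branchCoeff_le {V : Type*} [Fintype V] [Nonempty V]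
    {G : SimpleGraph V} [DecidableRel G.Adj] {d : ℝ} (hd : G.IsAdmissible d) (k : ℕ) :
    |(G.matchingPoly.roots.map fun r => (r / √d) ^ k).sum / Fintype.card V -
      (∑ u, branchCoeff G d k u) / Fintype.card V| ≤ deletionError k 0 / d := by
  classical
  have hV : (0 : ℝ) < Fintype.card V := by exact_mod_cast Fintype.card_pos
  have hsum : (G.matchingPoly.roots.map fun r => (r / √d) ^ k).sum =
      ∑ u, pathCoeff G d k Finset.univ u := by
    simp only [pathCoeff, div_pow, Multiset.sum_map_div, sum_pow_roots_matchingPoly,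
      Finset.sum_div]
  rw [← sub_div, abs_div, abs_of_pos hV, div_le_iff₀' hV, hsum, ← Finset.sum_sub_distrib]
  calc |∑ u, (pathCoeff G d k Finset.univ u - branchCoeff G d k u)|
      ≤ ∑ u, |pathCoeff G d k Finset.univ u - branchCoeff G d k u| :=
        Finset.abs_sum_le_sum_abs _ _
    _ ≤ Finset.univ.card • (deletionError k 0 / d) :=
        Finset.sum_le_card_nsmul _ _ _ fun u _ =>
          abs_pathCoeff_sub_branchCoeff_le hd k 0 (Finset.mem_univ u) (by simp)
    _ = Fintype.card V * (deletionError k 0 / d) := by rw [nsmul_eq_mul, Finset.card_univ]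

/-- The moments of the semicircle distribution on `[-2 √α, 2 √α]`. -/
noncomputable def scaledSemicircleMoment (α : ℝ) (k : ℕ) : ℝ :=
  semicircleMoment k * √α ^ k

theorem scaledSemicircleMoment_nonneg (α : ℝ) (k : ℕ) : 0 ≤ scaledSemicircleMoment α k :=
  mul_nonneg (semicircleMoment_nonneg k) (by positivity)

theorem scaledSemicircleMoment_add_two {α : ℝ} (hα : 0 ≤ α) (k : ℕ) :
    scaledSemicircleMoment α (k + 2) = ∑ i : Fin (k + 1),
      scaledSemicircleMoment α i * (α * scaledSemicircleMoment α (k - i)) := by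
  simp only [scaledSemicircleMoment]
  rw [semicircleMoment, Finset.sum_mul]
  refine Finset.sum_congr rfl fun i _ => ?_
  rw [sqrt_pow_add_two hα (Nat.le_of_lt_succ i.2)]
  ring

section Admissible

variable {V : Type*} [Fintype V] {G : SimpleGraph V} [DecidableRel G.Adj] {d : ℝ}

theorem sum_sum_neighborFinset_div_le (hd : G.IsAdmissible d) {f : V → ℝ} (hf : ∀ v, 0 ≤ f v) :
    ∑ u, (∑ v ∈ G.neighborFinset u, f v) / d ≤ ∑ v, f v := by
  rw [← Finset.sum_div, div_le_iff₀ (pos_of_isAdmissible hd),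
    Finset.sum_comm' (t' := Finset.univ) (s' := fun v => G.neighborFinset v)
      (by simp [G.adj_comm]),
    Finset.sum_mul]
  refine Finset.sum_le_sum fun v _ => ?_
  rw [Finset.sum_const, nsmul_eq_mul, mul_comm, G.card_neighborFinset_eq_degree]
  exact mul_le_mul_of_nonneg_left (hd.2 v) (hf v)

theorem abs_sum_neighborFinset_div_sub_le (hd : 0 < d) (f : V → ℝ) (u : V) {c : ℝ} (hc : 0 ≤ c)
    (α : ℝ) :
    |(∑ v ∈ G.neighborFinset u, f v) / d - α * c| ≤
      (∑ v ∈ G.neighborFinset u, |f v - c|) / d + c * |(G.degree u : ℝ) / d - α| := by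
  have hsplit : (∑ v ∈ G.neighborFinset u, f v) / d - α * c =
      (∑ v ∈ G.neighborFinset u, (f v - c)) / d + c * ((G.degree u : ℝ) / d - α) := by
    rw [Finset.sum_sub_distrib, Finset.sum_const, nsmul_eq_mul, G.card_neighborFinset_eq_degree]
    ring
  rw [hsplit]
  refine (abs_add_le _ _).trans ?_
  rw [abs_div, abs_of_pos hd, abs_mul, abs_of_nonneg hc]
  gcongr
  exact Finset.abs_sum_le_sum_abs _ _

theorem abs_branchCoeff_add_two_sub_le (hd : G.IsAdmissible d) {α : ℝ} (hα : 0 ≤ α) (k : ℕ)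
    (u : V) :
    |branchCoeff G d (k + 2) u - scaledSemicircleMoment α (k + 2)| ≤ ∑ i : Fin (k + 1),
      (|branchCoeff G d i u - scaledSemicircleMoment α i| * semicircleMoment (k - i) +
        scaledSemicircleMoment α i *
          ((∑ v ∈ G.neighborFinset u,
              |branchCoeff G d (k - i) v - scaledSemicircleMoment α (k - i)|) / d +
            scaledSemicircleMoment α (k - i) * |(G.degree u : ℝ) / d - α|)) := by
  rw [branchCoeff, scaledSemicircleMoment_add_two hα, ← Finset.sum_sub_distrib]
  refine (Finset.abs_sum_le_sum_abs _ _).trans (Finset.sum_le_sum fun i _ => ?_)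
  have hchildren := sum_div_mem_Icc hd (subset_refl (G.neighborFinset u))
    (fun v _ => branchCoeff_mem_Icc hd (k - i) v) (semicircleMoment_nonneg _)
  exact abs_mul_sub_mul_le le_rfl
    (abs_sum_neighborFinset_div_sub_le (pos_of_isAdmissible hd) _ u
      (scaledSemicircleMoment_nonneg α _) α)
    (abs_of_nonneg (scaledSemicircleMoment_nonneg α i)).le
    ((abs_of_nonneg hchildren.1).trans_le hchildren.2)

theorem sum_abs_branchCoeff_add_two_sub_le (hd : G.IsAdmissible d) {α : ℝ} (hα : 0 ≤ α) (k : ℕ) :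
    ∑ u, |branchCoeff G d (k + 2) u - scaledSemicircleMoment α (k + 2)| ≤ ∑ i : Fin (k + 1),
      ((∑ u, |branchCoeff G d i u - scaledSemicircleMoment α i|) * semicircleMoment (k - i) +
        scaledSemicircleMoment α i *
          (∑ u, |branchCoeff G d (k - i) u - scaledSemicircleMoment α (k - i)| +
            scaledSemicircleMoment α (k - i) * ∑ u, |(G.degree u : ℝ) / d - α|)) := by
  refine (Finset.sum_le_sum fun u _ => abs_branchCoeff_add_two_sub_le hd hα k u).trans ?_
  rw [Finset.sum_comm]
  refine Finset.sum_le_sum fun i _ => ?_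
  rw [Finset.sum_add_distrib, ← Finset.sum_mul, ← Finset.mul_sum, Finset.sum_add_distrib,
    ← Finset.mul_sum]
  have hchildren := sum_sum_neighborFinset_div_le hd fun v =>
    abs_nonneg (branchCoeff G d (k - i) v - scaledSemicircleMoment α (k - i))
  have hroot := scaledSemicircleMoment_nonneg α i
  gcongr

theorem abs_degree_div_sub_le_one (hd : G.IsAdmissible d) {α : ℝ} (hα : α ∈ Set.Icc 0 1) (v : V) :
    |(G.degree v : ℝ) / d - α| ≤ 1 := by
  have hd0 := pos_of_isAdmissible hd
  have hle : (G.degree v : ℝ) / d ≤ 1 := (div_le_one hd0).2 (hd.2 v)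
  have hnonneg : 0 ≤ (G.degree v : ℝ) / d := by positivity
  exact abs_le.2 ⟨by linarith [hα.2], by linarith [hα.1]⟩

end Admissible

theorem average_le_add_card_div {V : Type*} [Fintype V] [Nonempty V] {f : V → ℝ}
    (hf : ∀ v, f v ≤ 1) {ε : ℝ} (hε : 0 ≤ ε) :
    (∑ v, f v) / Fintype.card V ≤ ε + (Nat.card {v // ε ≤ f v} : ℝ) / Fintype.card V := by
  classical
  have hpointwise : ∀ v, f v ≤ ε + if ε ≤ f v then 1 else 0 := fun v => by
    split_ifs with hv
    · linarith [hf v]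
    · linarith
  have hcard : (Nat.card {v // ε ≤ f v} : ℝ) = ∑ v, if ε ≤ f v then (1 : ℝ) else 0 := by
    rw [Nat.card_eq_fintype_card, Fintype.card_subtype, Finset.sum_boole]
  calc (∑ v, f v) / Fintype.card V
      ≤ (∑ v, (ε + if ε ≤ f v then 1 else 0)) / Fintype.card V := by
        gcongr with v
        exact hpointwise v
    _ = ε + (Nat.card {v // ε ≤ f v} : ℝ) / Fintype.card V := by
        rw [Finset.sum_add_distrib, ← hcard, Finset.sum_const, Finset.card_univ, nsmul_eq_mul]
        field_simp

section Sequences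

variable {V : ℕ → Type*} [∀ n, Fintype (V n)] [∀ n, Nonempty (V n)] {G : ∀ n, SimpleGraph (V n)}
  [∀ n, DecidableRel (G n).Adj] {d : ℕ → ℝ} {α : ℝ}

theorem tendsto_average_abs_degree_sub (hadm : ∀ n, (G n).IsAdmissible (d n))
    (hα : α ∈ Set.Icc 0 1) (h : IsAsympRegular G d α) :
    Tendsto (fun n => (∑ u, |((G n).degree u : ℝ) / d n - α|) / Fintype.card (V n)) atTop
      (𝓝 0) := by
  refine tendsto_order.2
    ⟨fun a ha => .of_forall fun n => ha.trans_le (by positivity), fun ε hε => ?_⟩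
  filter_upwards [(h (ε / 2) (by positivity)).eventually_lt_const (half_pos hε)] with n hn
  linarith [average_le_add_card_div (abs_degree_div_sub_le_one (hadm n) hα) (half_pos hε).le]

theorem tendsto_average_abs_branchCoeff_sub (hadm : ∀ n, (G n).IsAdmissible (d n))
    (hα : α ∈ Set.Icc 0 1) (h : IsAsympRegular G d α) (k : ℕ) :
    Tendsto (fun n => (∑ u, |branchCoeff (G n) (d n) k u - scaledSemicircleMoment α k|) /
      Fintype.card (V n)) atTop (𝓝 0) := by
  induction k using Nat.strong_induction_on with
  | _ k ih =>
    match k with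
    | 0 => simp [scaledSemicircleMoment, semicircleMoment, branchCoeff]
    | 1 => simp [scaledSemicircleMoment, semicircleMoment, branchCoeff]
    | k + 2 =>
      have hdegree := tendsto_average_abs_degree_sub hadm hα h
      have hlim := tendsto_finsetSum (Finset.univ : Finset (Fin (k + 1))) fun i _ =>
        ((ih i (by omega)).mul_const (semicircleMoment (k - i))).add
          (((ih (k - i) (by omega)).add (hdegree.const_mul
            (scaledSemicircleMoment α (k - i)))).const_mul (scaledSemicircleMoment α i))
      simp only [zero_mul, mul_zero, add_zero, Finset.sum_const_zero] at hlim
      refine squeeze_zero (fun n => by positivity) (fun n => ?_) hlim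
      refine (div_le_div_of_nonneg_right (sum_abs_branchCoeff_add_two_sub_le (hadm n) hα.1 k)
        (by positivity)).trans_eq ?_
      rw [Finset.sum_div]
      exact Finset.sum_congr rfl fun i _ => by ring

theorem tendsto_average_branchCoeff (hadm : ∀ n, (G n).IsAdmissible (d n))
    (hα : α ∈ Set.Icc 0 1) (h : IsAsympRegular G d α) (k : ℕ) :
    Tendsto (fun n => (∑ u, branchCoeff (G n) (d n) k u) / Fintype.card (V n)) atTop
      (𝓝 (scaledSemicircleMoment α k)) := by
  rw [tendsto_iff_dist_tendsto_zero]
  refine squeeze_zero (fun n => dist_nonneg) (fun n => ?_)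
    (tendsto_average_abs_branchCoeff_sub hadm hα h k)
  have hV : (0 : ℝ) < Fintype.card (V n) := by exact_mod_cast Fintype.card_pos
  have hdiff : (∑ u, branchCoeff (G n) (d n) k u) / Fintype.card (V n) -
      scaledSemicircleMoment α k =
      (∑ u, (branchCoeff (G n) (d n) k u - scaledSemicircleMoment α k)) / Fintype.card (V n) := by
    rw [Finset.sum_sub_distrib, Finset.sum_const, Finset.card_univ, nsmul_eq_mul]
    field_simp
  rw [Real.dist_eq, hdiff, abs_div, abs_of_pos hV]
  gcongr
  exact Finset.abs_sum_le_sum_abs _ _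

end Sequences

/-- The shapes of rooted plane trees: a single root, or two trees with their roots joined by an
edge, rooted at the root of the first. -/
inductive TreeShape
  | leaf
  | graft (a b : TreeShape)

theorem isTree_sum_sup_edge {U₁ U₂ : Type*} [Finite U₁] [Finite U₂] {F₁ : SimpleGraph U₁}
    {F₂ : SimpleGraph U₂} (h₁ : F₁.IsTree) (h₂ : F₂.IsTree) (r₁ : U₁) (r₂ : U₂) :
    (F₁.sum F₂ ⊔ SimpleGraph.edge (Sum.inl r₁) (Sum.inr r₂)).IsTree := by
  classical
  have := Fintype.ofFinite U₁
  have := Fintype.ofFinite U₂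
  have hconnected := h₁.connected.sum_sup_edge (v := r₁) (w := r₂) h₂.connected
  refine SimpleGraph.isTree_iff_connected_and_card.2 ⟨hconnected, ?_⟩
  have hcard₁ := (SimpleGraph.isTree_iff_connected_and_card.1 h₁).2
  have hcard₂ := (SimpleGraph.isTree_iff_connected_and_card.1 h₂).2
  have hcard := (F₁.sum F₂).card_edgeFinset_sup_edge (s := Sum.inl r₁) (t := Sum.inr r₂)
    (by simp) (by simp)
  have hsum := Nat.card_congr (SimpleGraph.edgeSetSumEquiv (G := F₁) (H := F₂))
  rw [SimpleGraph.edgeFinset_card, SimpleGraph.edgeFinset_card, ← Nat.card_eq_fintype_card,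
    ← Nat.card_eq_fintype_card] at hcard
  rw [Nat.card_sum] at hsum ⊢
  omega

/-- A homomorphism from two rooted graphs joined by an edge between the roots is a pair of
homomorphisms mapping the roots to adjacent vertices. -/
def homGraftEquiv {U₁ U₂ V : Type*} {F₁ : SimpleGraph U₁} {F₂ : SimpleGraph U₂} {r₁ : U₁}
    {r₂ : U₂} {G : SimpleGraph V} {u : V} :
    {f : (F₁.sum F₂ ⊔ SimpleGraph.edge (Sum.inl r₁) (Sum.inr r₂)) →g G // f (Sum.inl r₁) = u} ≃
      {f : F₁ →g G // f r₁ = u} × Σ v : {v // G.Adj u v}, {f : F₂ →g G // f r₂ = v} where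
  toFun f :=
    ⟨⟨f.1.comp ((SimpleGraph.Hom.ofLE le_sup_left).comp SimpleGraph.Embedding.sumInl.toHom), f.2⟩,
      ⟨f.1 (Sum.inr r₂), by
        have h := f.1.map_adj (v := Sum.inl r₁) (w := Sum.inr r₂) (by simp [SimpleGraph.edge])
        rwa [f.2] at h⟩,
      ⟨f.1.comp ((SimpleGraph.Hom.ofLE le_sup_left).comp SimpleGraph.Embedding.sumInr.toHom), rfl⟩⟩
  invFun p := ⟨⟨Sum.elim p.1.1 p.2.2.1, by
    obtain ⟨⟨f, hf⟩, ⟨v, hv⟩, ⟨g, hg⟩⟩ := p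
    simp only at hg
    rintro (a | a) (b | b) h
    · exact f.map_adj (by simpa [SimpleGraph.edge] using h)
    · obtain ⟨rfl, rfl⟩ : a = r₁ ∧ b = r₂ := by simpa [SimpleGraph.edge] using h
      simpa [hf, hg] using hv
    · obtain ⟨rfl, rfl⟩ : a = r₂ ∧ b = r₁ := by simpa [SimpleGraph.edge] using h
      simpa [hf, hg] using hv.symm
    · exact g.map_adj (by simpa [SimpleGraph.edge] using h)⟩, p.1.2⟩
  left_inv f := by
    ext (a | a) <;> rfl
  right_inv := by
    rintro ⟨⟨f, hf⟩, ⟨v, hv⟩, ⟨g, hg⟩⟩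
    simp only at hg
    subst hg
    rfl

theorem homDensity_congr {U U' V : Type*} [Fintype U] [Fintype U'] [Fintype V]
    {F : SimpleGraph U} {F' : SimpleGraph U'} (e : F ≃g F') (G : SimpleGraph V) (d : ℝ) :
    F.homDensity G d = F'.homDensity G d := by
  have hhom : Nat.card (F →g G) = Nat.card (F' →g G) :=
    Nat.card_congr
      { toFun f := f.comp e.symm.toHom
        invFun f := f.comp e.toHom
        left_inv f := by ext; simp
        right_inv f := by ext; simp }
  rw [SimpleGraph.homDensity, SimpleGraph.homDensity, hhom, Fintype.card_congr e.toEquiv]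

namespace TreeShape

/-- The vertices of the tree of a given shape. -/
def Vertex : TreeShape → Type
  | leaf => Unit
  | graft a b => a.Vertex ⊕ b.Vertex

instance fintypeVertex : (T : TreeShape) → Fintype T.Vertex
  | leaf => inferInstanceAs (Fintype Unit)
  | graft a b =>
    have := fintypeVertex a
    have := fintypeVertex b
    inferInstanceAs (Fintype (a.Vertex ⊕ b.Vertex))

/-- The root of the tree of a given shape. -/
def root : (T : TreeShape) → T.Vertex
  | leaf => ()
  | graft a _ => Sum.inl a.root

/-- The tree of a given shape, as a graph. -/
def graph : (T : TreeShape) → SimpleGraph T.Vertex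
  | leaf => ⊥
  | graft a b => a.graph.sum b.graph ⊔ SimpleGraph.edge (Sum.inl a.root) (Sum.inr b.root)

theorem isTree_graph (T : TreeShape) : T.graph.IsTree := by
  induction T with
  | leaf => exact @SimpleGraph.IsTree.of_subsingleton Unit _ _ _
  | graft a b iha ihb => exact isTree_sum_sup_edge iha ihb a.root b.root

variable {V : Type*}

/-- The number of homomorphisms of a rooted tree into `G` that map the root to `u`. -/
noncomputable def numHoms (T : TreeShape) (G : SimpleGraph V) (u : V) : ℕ :=
  Nat.card {f : T.graph →g G // f T.root = u}

theorem numHoms_leaf (G : SimpleGraph V) (u : V) : leaf.numHoms G u = 1 := by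
  rw [numHoms, Nat.card_eq_one_iff_unique]
  refine ⟨⟨?_⟩, ⟨⟨⟨fun _ => u, fun h => h.elim⟩, rfl⟩⟩⟩
  rintro ⟨f, hf⟩ ⟨g, hg⟩
  ext ⟨⟩
  exact hf.trans hg.symm

/-- The number of homomorphisms of a rooted tree into `G` that map the root to `u`, normalized by
one factor `d` for every edge of the tree. -/
noncomputable def rootedDensity (T : TreeShape) (G : SimpleGraph V) (d : ℝ) (u : V) : ℝ :=
  (T.numHoms G u : ℝ) / d ^ (Fintype.card T.Vertex - 1)

theorem rootedDensity_leaf (G : SimpleGraph V) (d : ℝ) (u : V) : leaf.rootedDensity G d u = 1 := by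
  have hcard : Fintype.card leaf.Vertex = 1 := Fintype.card_unit
  simp [rootedDensity, numHoms_leaf, hcard]

variable [Fintype V]

theorem numHoms_graft (G : SimpleGraph V) [DecidableRel G.Adj] (a b : TreeShape) (u : V) :
    (graft a b).numHoms G u = a.numHoms G u * ∑ v ∈ G.neighborFinset u, b.numHoms G v := by
  have : Finite (b.graph →g G) := DFunLike.finite _
  refine (Nat.card_congr homGraftEquiv).trans ?_
  rw [Nat.card_prod, Nat.card_sigma]
  exact congrArg _ (Finset.sum_subtype _ (by simp) fun v => b.numHoms G v).symm

theorem sum_numHoms (G : SimpleGraph V) (T : TreeShape) :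
    ∑ u, T.numHoms G u = Nat.card (T.graph →g G) := by
  have : Finite (T.graph →g G) := DFunLike.finite _
  rw [← Nat.card_congr (Equiv.sigmaFiberEquiv fun f : T.graph →g G => f T.root), Nat.card_sigma]
  rfl

theorem rootedDensity_graft (G : SimpleGraph V) [DecidableRel G.Adj] (d : ℝ) (a b : TreeShape)
    (u : V) :
    (graft a b).rootedDensity G d u = a.rootedDensity G d u *
      ((∑ v ∈ G.neighborFinset u, b.rootedDensity G d v) / d) := by
  have hpos (T : TreeShape) : 0 < Fintype.card T.Vertex := Fintype.card_pos_iff.2 ⟨T.root⟩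
  have hcard : Fintype.card (graft a b).Vertex = Fintype.card a.Vertex + Fintype.card b.Vertex :=
    Fintype.card_sum
  have hexp : Fintype.card (graft a b).Vertex - 1 =
      (Fintype.card a.Vertex - 1) + (Fintype.card b.Vertex - 1) + 1 := by
    have := hpos a
    have := hpos b
    omega
  simp only [rootedDensity, numHoms_graft, hexp]
  push_cast
  rw [← Finset.sum_div]
  ring

theorem homDensity_graph (T : TreeShape) (G : SimpleGraph V) (d : ℝ) :
    T.graph.homDensity G d = (∑ u, T.rootedDensity G d u) / Fintype.card V := by
  simp only [SimpleGraph.homDensity, rootedDensity, ← Finset.sum_div, ← Nat.cast_sum, sum_numHoms]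
  rw [div_div, mul_comm]

end TreeShape

section Sequences

variable {V : ℕ → Type*} [∀ n, Fintype (V n)] (G : ∀ n, SimpleGraph (V n)) (d : ℕ → ℝ)

/-- The linear span of the rooted tree densities, as functions on the vertices of all the graphs
of a sequence. -/
noncomputable def treeSpan : Submodule ℝ (∀ n, V n → ℝ) :=
  Submodule.span ℝ (Set.range fun (T : TreeShape) n => T.rootedDensity (G n) (d n))

variable {G d}

theorem exists_tendsto_average_of_mem_treeSpan (h : TreeDensitiesConverge G d)
    {f : ∀ n, V n → ℝ} (hf : f ∈ treeSpan G d) :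
    ∃ t, Tendsto (fun n => (∑ u, f n u) / Fintype.card (V n)) atTop (𝓝 t) := by
  induction hf using Submodule.span_induction with
  | mem f hf =>
    obtain ⟨T, rfl⟩ := hf
    obtain ⟨t, ht⟩ := h _ _ ((T.graph.overFinIso rfl).isTree_iff.1 T.isTree_graph)
    exact ⟨t, ht.congr fun n =>
      (homDensity_congr (T.graph.overFinIso rfl) (G n) (d n)).symm.trans
        (T.homDensity_graph (G n) (d n))⟩
  | zero => exact ⟨0, by simp⟩
  | add f g _ _ hf hg =>
    obtain ⟨s, hs⟩ := hf
    obtain ⟨t, ht⟩ := hg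
    exact ⟨s + t, by simpa only [Pi.add_apply, Finset.sum_add_distrib, add_div] using hs.add ht⟩
  | smul c f _ hf =>
    obtain ⟨s, hs⟩ := hf
    exact ⟨c * s, by
      simpa only [Pi.smul_apply, smul_eq_mul, ← Finset.mul_sum, mul_div_assoc]
        using hs.const_mul c⟩

variable (G d) [∀ n, DecidableRel (G n).Adj]

/-- The bilinear operation on functions on the vertices that grafting of trees induces on the
rooted tree densities. -/
noncomputable def graftLinear :
    (∀ n, V n → ℝ) →ₗ[ℝ] (∀ n, V n → ℝ) →ₗ[ℝ] (∀ n, V n → ℝ) :=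
  LinearMap.mk₂ ℝ (fun f g n u => f n u * ((∑ v ∈ (G n).neighborFinset u, g n v) / d n))
    (fun f f' g => by ext; simp only [Pi.add_apply]; ring)
    (fun c f g => by ext; simp only [Pi.smul_apply, smul_eq_mul]; ring)
    (fun f g g' => by ext; simp only [Pi.add_apply, Finset.sum_add_distrib]; ring)
    (fun c f g => by ext; simp only [Pi.smul_apply, smul_eq_mul, ← Finset.mul_sum]; ring)

variable {G d}

theorem graftLinear_mem_treeSpan {f g : ∀ n, V n → ℝ} (hf : f ∈ treeSpan G d)
    (hg : g ∈ treeSpan G d) : graftLinear G d f g ∈ treeSpan G d := by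
  refine Submodule.map₂_le.1 ?_ f hf g hg
  rw [treeSpan, Submodule.map₂_span_span]
  refine Submodule.span_mono ?_
  rintro _ ⟨_, ⟨a, rfl⟩, _, ⟨b, rfl⟩, rfl⟩
  refine ⟨a.graft b, ?_⟩
  ext n u
  exact TreeShape.rootedDensity_graft (G n) (d n) a b u

theorem branchCoeff_mem_treeSpan (k : ℕ) :
    (fun n u => branchCoeff (G n) (d n) k u) ∈ treeSpan G d := by
  induction k using Nat.strong_induction_on with
  | _ k ih =>
    match k with
    | 0 =>
      refine Submodule.subset_span ⟨TreeShape.leaf, ?_⟩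
      ext n u
      rw [branchCoeff]
      exact TreeShape.rootedDensity_leaf (G n) (d n) u
    | 1 =>
      convert (treeSpan G d).zero_mem using 1
      ext n u
      rw [branchCoeff, Pi.zero_apply, Pi.zero_apply]
    | k + 2 =>
      convert (treeSpan G d).sum_mem (t := (Finset.univ : Finset (Fin (k + 1)))) fun i _ =>
        graftLinear_mem_treeSpan (ih i (by omega)) (ih (k - i) (by omega)) using 1
      ext n u
      simp only [branchCoeff, Finset.sum_apply, graftLinear, LinearMap.mk₂_apply]

end Sequences

section MomentMethod

section CompactSupport

variable {X : Type*} [TopologicalSpace X] [MeasurableSpace X] [OpensMeasurableSpace X]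
  {K : Set X} {f : X → ℝ}

theorem integrable_of_continuous_of_ae_mem [T2Space X] {μ : Measure X} [IsFiniteMeasure μ]
    (hf : Continuous f) (hK : IsCompact K) (hμ : ∀ᵐ x ∂μ, x ∈ K) : Integrable f μ := by
  have := hf.continuousOn.integrableOn_compact (μ := μ) hK
  rwa [IntegrableOn, Measure.restrict_eq_self_of_ae_mem hμ] at this

theorem tendsto_integral_of_ae_mem {ι : Type*} {l : Filter ι} {μ : ι → ProbabilityMeasure X}
    {ν : ProbabilityMeasure X} (h : Tendsto μ l (𝓝 ν)) (hf : Continuous f) (hK : IsCompact K)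
    (hμ : ∀ n, ∀ᵐ x ∂(μ n : Measure X), x ∈ K) (hν : ∀ᵐ x ∂(ν : Measure X), x ∈ K) :
    Tendsto (fun n => ∫ x, f x ∂(μ n : Measure X)) l (𝓝 (∫ x, f x ∂(ν : Measure X))) := by
  obtain ⟨C, hC⟩ := hK.exists_bound_of_continuousOn hf.continuousOn
  let g : BoundedContinuousFunction X ℝ :=
    .ofNormedAddCommGroup (fun x => max (-|C|) (min (f x) |C|)) (by fun_prop) |C| fun x =>
      abs_le.2 ⟨le_max_left _ _, max_le (by linarith [abs_nonneg C]) (min_le_right _ _)⟩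
  have hfg (m : Measure X) (hm : ∀ᵐ x ∂m, x ∈ K) : ∫ x, f x ∂m = ∫ x, g x ∂m := by
    refine integral_congr_ae ?_
    filter_upwards [hm] with x hx
    obtain ⟨hl, hu⟩ := abs_le.1 ((hC x hx).trans (le_abs_self C))
    exact ((congrArg _ (min_eq_left hu)).trans (max_eq_right hl)).symm
  simp only [hfg _ hν, fun n => hfg _ (hμ n)]
  exact ProbabilityMeasure.tendsto_iff_forall_integral_tendsto.1 h g

theorem isCompact_setOf_ae_mem [T2Space X] [BorelSpace X] (hK : IsCompact K) :
    IsCompact {μ : ProbabilityMeasure X | ∀ᵐ x ∂(μ : Measure X), x ∈ K} := by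
  have h := isCompact_setOfPred_probabilityMeasure_mass_eq_compl_isCompact_le (u := fun _ => 0)
    (K := fun _ => K) tendsto_const_nhds (fun _ => hK) (Or.inr monotone_const)
  simp only [nonpos_iff_eq_zero, ProbabilityMeasure.null_iff_toMeasure_null, forall_const] at h
  exact h

end CompactSupport

theorem integral_eval_eq_sum {μ : Measure ℝ} (h : ∀ k : ℕ, Integrable (fun x => x ^ k) μ)
    (p : ℝ[X]) :
    ∫ x, p.eval x ∂μ = ∑ k ∈ Finset.range (p.natDegree + 1), p.coeff k * ∫ x, x ^ k ∂μ := by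
  simp only [Polynomial.eval_eq_sum_range]
  rw [integral_finsetSum _ fun k _ => (h k).const_mul _]
  simp only [integral_const_mul]

theorem abs_integral_sub_integral_le {X : Type*} [MeasurableSpace X] {μ : Measure X}
    [IsProbabilityMeasure μ] {f g : X → ℝ} (hf : Integrable f μ) (hg : Integrable g μ) {ε : ℝ}
    (hfg : ∀ᵐ x ∂μ, |f x - g x| ≤ ε) : |∫ x, f x ∂μ - ∫ x, g x ∂μ| ≤ ε := by
  rw [← integral_sub hf hg]
  simpa using norm_integral_le_of_norm_le_const (f := fun x => f x - g x) hfg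

variable {ι : Type*} {l : Filter ι} {a b : ℝ} {μ : ι → ProbabilityMeasure ℝ}

theorem tendsto_of_tendsto_moments {ν : ProbabilityMeasure ℝ}
    (hμ : ∀ n, ∀ᵐ x ∂(μ n : Measure ℝ), x ∈ Set.Icc a b)
    (hν : ∀ᵐ x ∂(ν : Measure ℝ), x ∈ Set.Icc a b)
    (h : ∀ k : ℕ, Tendsto (fun n => ∫ x, x ^ k ∂(μ n : Measure ℝ)) l
      (𝓝 (∫ x, x ^ k ∂(ν : Measure ℝ)))) :
    Tendsto μ l (𝓝 ν) := by
  have hint {m : ProbabilityMeasure ℝ} (hm : ∀ᵐ x ∂(m : Measure ℝ), x ∈ Set.Icc a b) {g : ℝ → ℝ}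
      (hg : Continuous g) : Integrable g (m : Measure ℝ) :=
    integrable_of_continuous_of_ae_mem hg isCompact_Icc hm
  refine ProbabilityMeasure.tendsto_iff_forall_integral_tendsto.2 fun f =>
    Metric.tendsto_nhds.2 fun ε hε => ?_
  obtain ⟨p, hp⟩ := exists_polynomial_near_of_continuousOn a b f f.continuous.continuousOn (ε / 3)
    (by positivity)
  have hclose {m : ProbabilityMeasure ℝ} (hm : ∀ᵐ x ∂(m : Measure ℝ), x ∈ Set.Icc a b) :
      |∫ x, p.eval x ∂(m : Measure ℝ) - ∫ x, f x ∂(m : Measure ℝ)| ≤ ε / 3 :=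
    abs_integral_sub_integral_le (hint hm p.continuous) (hint hm f.continuous)
      (hm.mono fun x hx => (hp x hx).le)
  have hpoly : Tendsto (fun n => ∫ x, p.eval x ∂(μ n : Measure ℝ)) l
      (𝓝 (∫ x, p.eval x ∂(ν : Measure ℝ))) := by
    simp only [integral_eval_eq_sum fun k => hint hν (continuous_pow k),
      fun n => integral_eval_eq_sum fun k => hint (hμ n) (continuous_pow k)]
    exact tendsto_finsetSum _ fun k _ => (h k).const_mul _
  filter_upwards [Metric.tendsto_nhds.1 hpoly (ε / 3) (by positivity)] with n hn
  have hμn := abs_le.1 (hclose (hμ n))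
  have hν' := abs_le.1 (hclose hν)
  rw [Real.dist_eq, abs_lt] at hn ⊢
  constructor <;> linarith [hμn.1, hμn.2, hν'.1, hν'.2]

theorem exists_tendsto_of_moments_tendsto [l.NeBot]
    (hμ : ∀ n, ∀ᵐ x ∂(μ n : Measure ℝ), x ∈ Set.Icc a b)
    (h : ∀ k : ℕ, ∃ t, Tendsto (fun n => ∫ x, x ^ k ∂(μ n : Measure ℝ)) l (𝓝 t)) :
    ∃ ν : ProbabilityMeasure ℝ, (∀ᵐ x ∂(ν : Measure ℝ), x ∈ Set.Icc a b) ∧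
      Tendsto μ l (𝓝 ν) := by
  obtain ⟨ν, hν, hlim⟩ := (isCompact_setOf_ae_mem isCompact_Icc).ultrafilter_le_nhds'
    ((Ultrafilter.of l).map μ) (Ultrafilter.mem_map.2 (univ_mem' hμ))
  refine ⟨ν, hν, tendsto_of_tendsto_moments hμ hν fun k => ?_⟩
  obtain ⟨t, ht⟩ := h k
  have hultra := tendsto_integral_of_ae_mem hlim (continuous_pow k) isCompact_Icc hμ hν
  rwa [tendsto_nhds_unique hultra (ht.mono_left (Ultrafilter.of_le l))]

end MomentMethod

section SumDirac

variable {X : Type*} [MeasurableSpace X]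

theorem ae_mem_sum_dirac {s : Multiset X} {t : Set X} (ht : MeasurableSet t)
    (h : ∀ x ∈ s, x ∈ t) : ∀ᵐ x ∂(s.map Measure.dirac).sum, x ∈ t := by
  induction s using Multiset.induction with
  | empty => simp
  | cons x s ih =>
    rw [Multiset.forall_mem_cons] at h
    rw [Multiset.map_cons, Multiset.sum_cons, ae_add_measure_iff]
    exact ⟨(ae_dirac_iff ht).2 h.1, ih h.2⟩

theorem sum_dirac_apply_univ (s : Multiset X) :
    (s.map Measure.dirac).sum Set.univ = s.card := by
  induction s using Multiset.induction with
  | empty => simp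
  | cons x s ih => simp [ih, add_comm]

variable [MeasurableSingletonClass X]

theorem integrable_sum_dirac (s : Multiset X) (f : X → ℝ) :
    Integrable f (s.map Measure.dirac).sum := by
  induction s using Multiset.induction with
  | empty => simp
  | cons x s ih =>
    rw [Multiset.map_cons, Multiset.sum_cons]
    exact (integrable_dirac (by simp)).add_measure ih

theorem integral_sum_dirac (s : Multiset X) (f : X → ℝ) :
    ∫ x, f x ∂(s.map Measure.dirac).sum = (s.map f).sum := by
  induction s using Multiset.induction with
  | empty => simp
  | cons x s ih =>
    simp only [Multiset.map_cons, Multiset.sum_cons]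
    rw [integral_add_measure (integrable_dirac (by simp)) (integrable_sum_dirac s f), ih,
      integral_dirac]

end SumDirac

section RegularizedLogAbs

/-- A continuous regularization of `log |x|`, decreasing to it as `ε` decreases to `0`. -/
noncomputable def regularizedLogAbs (ε x : ℝ) : ℝ :=
  Real.log (ε + x ^ 2) / 2

theorem continuous_regularizedLogAbs {ε : ℝ} (hε : 0 < ε) :
    Continuous (regularizedLogAbs ε) :=
  (Continuous.log (by fun_prop) fun x => by positivity).div_const 2

theorem regularizedLogAbs_le_regularizedLogAbs {δ ε : ℝ} (hδ : 0 < δ) (h : δ ≤ ε) (x : ℝ) :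
    regularizedLogAbs δ x ≤ regularizedLogAbs ε x := by
  unfold regularizedLogAbs
  gcongr

theorem extendedLogAbs_of_ne_zero {x : ℝ} (hx : x ≠ 0) :
    extendedLogAbs x = (Real.log x : EReal) := by
  rw [extendedLogAbs, ENNReal.log_ofReal_of_pos (abs_pos.2 hx), Real.log_abs]

theorem extendedLogAbs_zero : extendedLogAbs 0 = ⊥ := by
  simp [extendedLogAbs]

theorem tendsto_regularizedLogAbs (x : ℝ) :
    Tendsto (fun ε => (regularizedLogAbs ε x : EReal)) (𝓝[>] 0) (𝓝 (extendedLogAbs x)) := by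
  unfold regularizedLogAbs
  rcases eq_or_ne x 0 with rfl | hx
  · rw [extendedLogAbs_zero, EReal.tendsto_coe_nhds_bot_iff]
    simpa using Real.tendsto_log_nhdsGT_zero.atBot_div_const two_pos
  · have hlog : Real.log x = Real.log (0 + x ^ 2) / 2 := by
      rw [zero_add, Real.log_pow, Nat.cast_ofNat, mul_div_cancel_left₀ _ two_ne_zero]
    rw [extendedLogAbs_of_ne_zero hx, hlog]
    refine (continuous_coe_real_ereal.tendsto _).comp (Tendsto.div_const ?_ 2)
    exact ((tendsto_id.mono_left nhdsWithin_le_nhds).add_const _).log (by positivity)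

end RegularizedLogAbs

section RootDistribution

variable {V : Type*} [Fintype V] (G : SimpleGraph V) (d : ℝ)

theorem matchingMeasure_eq_smul_sum_dirac :
    G.matchingMeasure d = (Fintype.card V : ℝ≥0∞)⁻¹ •
      ((G.matchingPoly.roots.map fun r => r / √d).map Measure.dirac).sum := by
  rw [SimpleGraph.matchingMeasure, Multiset.map_map]
  rfl

theorem integral_matchingMeasure (f : ℝ → ℝ) :
    ∫ x, f x ∂G.matchingMeasure d =
      (G.matchingPoly.roots.map fun r => f (r / √d)).sum / Fintype.card V := by
  rw [matchingMeasure_eq_smul_sum_dirac, integral_smul_measure, integral_sum_dirac,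
    Multiset.map_map]
  simp [div_eq_inv_mul]

theorem isProbabilityMeasure_matchingMeasure [Nonempty V] :
    IsProbabilityMeasure (G.matchingMeasure d) := by
  constructor
  rw [matchingMeasure_eq_smul_sum_dirac, Measure.smul_apply, sum_dirac_apply_univ,
    Multiset.card_map, card_roots_matchingPoly, smul_eq_mul]
  exact ENNReal.inv_mul_cancel (by simp) (by simp)

/-- The matching measure as a point of the space of probability measures on `ℝ`. -/
noncomputable def matchingProbabilityMeasure [Nonempty V] : ProbabilityMeasure ℝ :=
  ⟨G.matchingMeasure d, isProbabilityMeasure_matchingMeasure G d⟩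

theorem totalMatchings_pos : 0 < G.totalMatchings := by
  have hprod : 0 < (G.matchingPoly.roots.map fun r => 1 + r ^ 2).prod :=
    Multiset.prod_pos (Multiset.forall_mem_map_iff.2 fun r _ => by positivity)
  rw [← totalMatchings_sq] at hprod
  exact Nat.pos_of_ne_zero fun h => by simp [h] at hprod

theorem two_mul_log_totalMatchings :
    2 * Real.log G.totalMatchings =
      (G.matchingPoly.roots.map fun r => Real.log (1 + r ^ 2)).sum := by
  have hsq := Real.log_pow (G.totalMatchings : ℝ) 2
  rw [totalMatchings_sq, Real.log_multiset_prod
    (Multiset.forall_mem_map_iff.2 fun r _ => by positivity), Multiset.map_map] at hsq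
  exact_mod_cast hsq.symm

variable {G d}

theorem log_totalMatchings_eq_integral [Nonempty V] (hd : 0 < d) :
    Real.log ((G.totalMatchings : ℝ) ^ (2 / (Fintype.card V : ℝ)) / d) =
      2 * ∫ x, regularizedLogAbs d⁻¹ x ∂G.matchingMeasure d := by
  have hM : (0 : ℝ) < G.totalMatchings := by exact_mod_cast totalMatchings_pos G
  have hroot (r : ℝ) :
      regularizedLogAbs d⁻¹ (r / √d) = (Real.log (1 + r ^ 2) - Real.log d) / 2 := by
    rw [regularizedLogAbs, ← Real.log_div (by positivity) hd.ne', div_pow, Real.sq_sqrt hd.le]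
    congr 2
    field_simp
  rw [Real.log_div (by positivity) hd.ne', Real.log_rpow hM, integral_matchingMeasure]
  simp only [hroot]
  rw [Multiset.sum_map_div, Multiset.sum_map_sub, Multiset.map_const', Multiset.sum_replicate,
    card_roots_matchingPoly, ← two_mul_log_totalMatchings, nsmul_eq_mul]
  field_simp

theorem ae_matchingMeasure_mem_Icc [DecidableRel G.Adj] (hd : G.IsAdmissible d) :
    ∀ᵐ x ∂G.matchingMeasure d, x ∈ Set.Icc (-2) 2 := by
  have hd0 := pos_of_isAdmissible hd
  have hs : 0 < √d := Real.sqrt_pos.2 hd0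
  rw [matchingMeasure_eq_smul_sum_dirac]
  refine Measure.ae_smul_measure (ae_mem_sum_dirac measurableSet_Icc ?_) _
  refine Multiset.forall_mem_map_iff.2 fun r hr => ?_
  rw [Set.mem_Icc, ← abs_le, abs_div, abs_of_pos hs, div_le_iff₀ hs]
  exact abs_le_of_mem_roots_matchingPoly hs (by simpa only [Real.sq_sqrt hd0.le] using hd.2) hr

end RootDistribution

section Limits

variable {V : ℕ → Type*} [∀ n, Fintype (V n)] [∀ n, Nonempty (V n)] {G : ∀ n, SimpleGraph (V n)}
  [∀ n, DecidableRel (G n).Adj] {d : ℕ → ℝ}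

theorem tendsto_moment_matchingMeasure (hadm : ∀ n, (G n).IsAdmissible (d n))
    (hd : Tendsto d atTop atTop) {k : ℕ} {t : ℝ}
    (h : Tendsto (fun n => (∑ u, branchCoeff (G n) (d n) k u) / Fintype.card (V n)) atTop (𝓝 t)) :
    Tendsto (fun n => ∫ x, x ^ k ∂(G n).matchingMeasure (d n)) atTop (𝓝 t) := by
  have hdiff : Tendsto (fun n => ∫ x, x ^ k ∂(G n).matchingMeasure (d n) -
      (∑ u, branchCoeff (G n) (d n) k u) / Fintype.card (V n)) atTop (𝓝 0) := by
    refine squeeze_zero_norm (fun n => ?_) (hd.const_div_atTop (deletionError k 0))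
    rw [integral_matchingMeasure]
    exact abs_average_pow_roots_sub_average_branchCoeff_le (hadm n) k
  simpa using hdiff.add h

theorem exists_tendsto_matchingProbabilityMeasure (hadm : ∀ n, (G n).IsAdmissible (d n))
    (hd : Tendsto d atTop atTop) (h : TreeDensitiesConverge G d) :
    ∃ ρ : ProbabilityMeasure ℝ, (∀ᵐ x ∂(ρ : Measure ℝ), x ∈ Set.Icc (-2) 2) ∧
      Tendsto (fun n => matchingProbabilityMeasure (G n) (d n)) atTop (𝓝 ρ) := by
  refine exists_tendsto_of_moments_tendsto (fun n => ae_matchingMeasure_mem_Icc (hadm n))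
    fun k => ?_
  obtain ⟨t, ht⟩ := exists_tendsto_average_of_mem_treeSpan h (branchCoeff_mem_treeSpan k)
  exact ⟨t, tendsto_moment_matchingMeasure hadm hd ht⟩

end Limits

section SemicircleMoments

theorem sum_range_eq_sum_range_even_of_odd_eq_zero {M : Type*} [AddCommMonoid M] {f : ℕ → M}
    (hf : ∀ i, f (2 * i + 1) = 0) (j : ℕ) :
    ∑ i ∈ Finset.range (2 * j + 1), f i = ∑ i ∈ Finset.range (j + 1), f (2 * i) := by
  induction j with
  | zero => simp
  | succ j ih =>
    rw [Finset.sum_range_succ _ (j + 1), ← ih, show 2 * (j + 1) + 1 = 2 * j + 1 + 1 + 1 by ring,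
      Finset.sum_range_succ, Finset.sum_range_succ, hf, add_zero]
    rfl

theorem semicircleMoment_odd (j : ℕ) : semicircleMoment (2 * j + 1) = 0 := by
  induction j using Nat.strong_induction_on with
  | _ j ih =>
    rcases j with _ | j
    · simp [semicircleMoment]
    · rw [show 2 * (j + 1) + 1 = 2 * j + 1 + 2 by ring, semicircleMoment]
      refine Finset.sum_eq_zero fun i _ => ?_
      rcases Nat.even_or_odd' (i : ℕ) with ⟨m, hm | hm⟩
      · rw [show 2 * j + 1 - (i : ℕ) = 2 * (j - m) + 1 by omega, ih _ (by omega), mul_zero]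
      · rw [hm, ih _ (by omega), zero_mul]

theorem semicircleMoment_even (j : ℕ) : semicircleMoment (2 * j) = catalan j := by
  induction j using Nat.strong_induction_on with
  | _ j ih =>
    rcases j with _ | j
    · simp [semicircleMoment]
    · rw [show 2 * (j + 1) = 2 * j + 2 by ring, semicircleMoment, catalan_succ,
        Fin.sum_univ_eq_sum_range (fun i => semicircleMoment i * semicircleMoment (2 * j - i)),
        sum_range_eq_sum_range_even_of_odd_eq_zero fun i => by
          rw [semicircleMoment_odd, zero_mul],
        Fin.sum_univ_eq_sum_range (fun i => catalan i * catalan (j - i))]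
      push_cast
      refine Finset.sum_congr rfl fun i hi => ?_
      have := Finset.mem_range.1 hi
      rw [← Nat.mul_sub, ih _ (by omega), ih _ (by omega)]

theorem add_two_mul_catalan_succ (n : ℕ) :
    (n + 2) * catalan (n + 1) = 2 * (2 * n + 1) * catalan n := by
  refine Nat.eq_of_mul_eq_mul_left n.succ_pos ?_
  calc (n + 1) * ((n + 2) * catalan (n + 1))
      = (n + 1) * Nat.centralBinom (n + 1) := by rw [← succ_mul_catalan_eq_centralBinom (n + 1)]
    _ = 2 * (2 * n + 1) * Nat.centralBinom n := Nat.succ_mul_centralBinom_succ n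
    _ = (n + 1) * (2 * (2 * n + 1) * catalan n) := by
        rw [← succ_mul_catalan_eq_centralBinom n]; ring

theorem semicircleMoment_recurrence (k : ℕ) :
    (k + 4) * semicircleMoment (k + 2) = 4 * (k + 1) * semicircleMoment k := by
  rcases Nat.even_or_odd' k with ⟨j, rfl | rfl⟩
  · have hcatalan : ((j : ℝ) + 2) * catalan (j + 1) = 2 * (2 * j + 1) * catalan j := by
      exact_mod_cast add_two_mul_catalan_succ j
    rw [show 2 * j + 2 = 2 * (j + 1) by ring, semicircleMoment_even, semicircleMoment_even]
    push_cast
    linear_combination 2 * hcatalan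
  · rw [show 2 * j + 1 + 2 = 2 * (j + 1) + 1 by ring, semicircleMoment_odd, semicircleMoment_odd,
      mul_zero, mul_zero]

end SemicircleMoments

section Parity

variable {E : Type*} [NormedAddCommGroup E] [NormedSpace ℝ E] {f : ℝ → E}

theorem intervalIntegral_neg_self_eq_zero_of_odd (hf : ∀ x, f (-x) = -f x) (a : ℝ) :
    ∫ x in -a..a, f x = 0 := by
  have h := intervalIntegral.integral_comp_neg (a := -a) (b := a) f
  simp only [hf, neg_neg, intervalIntegral.integral_neg] at h
  have : IsAddTorsionFree E := .of_isTorsionFree ℝ E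
  exact self_eq_neg.1 h.symm

theorem intervalIntegral_neg_self_eq_two_smul_of_even (hf : ∀ x, f (-x) = f x) {a : ℝ}
    (hint : IntervalIntegrable f volume 0 a) :
    ∫ x in -a..a, f x = (2 : ℝ) • ∫ x in (0 : ℝ)..a, f x := by
  have hneg := intervalIntegral.integral_comp_neg (a := -a) (b := 0) f
  have hint' : IntervalIntegrable f volume (-a) 0 := by
    simpa only [hf, neg_zero] using (IntervalIntegrable.iff_comp_neg).1 hint.symm
  simp only [hf, neg_neg, neg_zero] at hneg
  rw [← intervalIntegral.integral_add_adjacent_intervals hint' hint, hneg, two_smul]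

end Parity

section WignerMeasure

theorem integral_wignerMeasure {E : Type*} [NormedAddCommGroup E] [NormedSpace ℝ E] (f : ℝ → E) :
    ∫ x, f x ∂wignerMeasure = ∫ x in (-2 : ℝ)..2, semicircleDensity x • f x := by
  rw [wignerMeasure, integral_withDensity_eq_integral_toReal_smul
    (by have := continuous_semicircleDensity; fun_prop) (by simp),
    intervalIntegral.integral_of_le (by norm_num), setIntegral_eq_integral_of_forall_compl_eq_zero]
  · simp only [ENNReal.toReal_ofReal (semicircleDensity_nonneg _)]
  · intro x hx
    rw [semicircleDensity_eq_zero hx, zero_smul]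

theorem integral_wignerMeasure_eq_div (f : ℝ → ℝ) :
    ∫ x, f x ∂wignerMeasure =
      (∫ x in (-2 : ℝ)..2, √(4 - x ^ 2) * f x) / (2 * Real.pi) := by
  rw [integral_wignerMeasure, ← intervalIntegral.integral_div]
  simp only [semicircleDensity, smul_eq_mul, div_mul_eq_mul_div]

theorem integrable_wignerMeasure {f : ℝ → ℝ} (hf : IntervalIntegrable f volume (-2) 2) :
    Integrable f wignerMeasure := by
  have hsmul := hf.continuousOn_mul continuous_semicircleDensity.continuousOn
  rw [intervalIntegrable_iff_integrableOn_Ioc_of_le (by norm_num)] at hsmul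
  rw [wignerMeasure, integrable_withDensity_iff_integrable_smul'
    (by have := continuous_semicircleDensity; fun_prop) (by simp)]
  simp only [ENNReal.toReal_ofReal (semicircleDensity_nonneg _), smul_eq_mul]
  refine hsmul.integrable_of_forall_notMem_eq_zero fun x hx => ?_
  rw [semicircleDensity_eq_zero hx, zero_mul]

theorem ae_wignerMeasure_mem_Icc : ∀ᵐ x ∂wignerMeasure, x ∈ Set.Icc (-2) 2 := by
  rw [wignerMeasure, ae_withDensity_iff
    (by have := continuous_semicircleDensity; fun_prop)]
  refine Eventually.of_forall fun x hx => ?_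
  by_contra hx'
  exact hx (by rw [semicircleDensity_eq_zero fun h => hx' (Set.Ioc_subset_Icc_self h),
    ENNReal.ofReal_zero])

theorem ae_wignerMeasure_ne (a : ℝ) : ∀ᵐ x ∂wignerMeasure, x ≠ a :=
  (withDensity_absolutelyContinuous _ _).ae_le (Measure.ae_ne volume a)

theorem hasDerivAt_pow_mul_mul_sqrt (k : ℕ) {x : ℝ} (hx : 0 < 4 - x ^ 2) :
    HasDerivAt (fun x => x ^ (k + 1) * ((4 - x ^ 2) * √(4 - x ^ 2)))
      (4 * (k + 1) * (√(4 - x ^ 2) * x ^ k) - (k + 4) * (√(4 - x ^ 2) * x ^ (k + 2))) x := by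
  have hquad : HasDerivAt (fun x : ℝ => 4 - x ^ 2) (-(2 * x)) x := by
    simpa using (hasDerivAt_pow 2 x).const_sub 4
  have hsqrt : (4 - x ^ 2) * (-(2 * x) / (2 * √(4 - x ^ 2))) = -x * √(4 - x ^ 2) := by
    have : 0 < √(4 - x ^ 2) := Real.sqrt_pos.2 hx
    rw [mul_div_assoc', div_eq_iff (by positivity)]
    linear_combination 2 * x * Real.sq_sqrt hx.le
  convert! (hasDerivAt_pow (k + 1) x).mul (hquad.mul (hquad.sqrt hx.ne')) using 1
  simp only [Pi.mul_apply, Nat.add_sub_cancel, hsqrt]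
  push_cast
  ring

theorem integral_sqrt_mul_pow_recurrence (k : ℕ) :
    (k + 4) * ∫ x in (-2 : ℝ)..2, √(4 - x ^ 2) * x ^ (k + 2) =
      4 * (k + 1) * ∫ x in (-2 : ℝ)..2, √(4 - x ^ 2) * x ^ k := by
  have hint (c : ℝ) (j : ℕ) :
      IntervalIntegrable (fun x => c * (√(4 - x ^ 2) * x ^ j)) volume (-2) 2 :=
    Continuous.intervalIntegrable (by fun_prop) _ _
  have h := intervalIntegral.integral_eq_sub_of_hasDerivAt_of_le (a := (-2 : ℝ)) (b := 2)
    (by norm_num) (by fun_prop)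
    (fun x hx => hasDerivAt_pow_mul_mul_sqrt k (by nlinarith [hx.1, hx.2]))
    ((hint _ _).sub (hint _ _))
  rw [intervalIntegral.integral_sub (hint _ _) (hint _ _), intervalIntegral.integral_const_mul,
    intervalIntegral.integral_const_mul] at h
  simp only [even_two, Even.neg_pow, show (4 : ℝ) - 2 ^ 2 = 0 by norm_num, Real.sqrt_zero, mul_zero,
    sub_self] at h
  linarith

theorem integral_pow_wignerMeasure (k : ℕ) :
    ∫ x, x ^ k ∂wignerMeasure = semicircleMoment k := by
  induction k using Nat.twoStepInduction with
  | zero => simp [semicircleMoment]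
  | one =>
    rw [integral_wignerMeasure_eq_div, intervalIntegral_neg_self_eq_zero_of_odd (by simp), zero_div,
      semicircleMoment]
  | more k ih _ =>
    rw [integral_wignerMeasure_eq_div] at ih ⊢
    refine mul_left_cancel₀ (by positivity : (k : ℝ) + 4 ≠ 0) ?_
    rw [semicircleMoment_recurrence, ← mul_div_assoc, integral_sqrt_mul_pow_recurrence,
      mul_div_assoc, ih]

end WignerMeasure

section WignerLog

open Real (cos sin log)

theorem intervalIntegrable_log_two_mul_sin (a b : ℝ) :
    IntervalIntegrable (fun θ => log (2 * sin θ)) volume a b := by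
  have h : AnalyticOnNhd ℝ (fun θ => 2 * sin θ) (Set.uIcc a b) := fun θ _ => by fun_prop
  exact h.meromorphicOn.intervalIntegrable_log

theorem integral_log_two_mul_sin : ∫ θ in 0..Real.pi / 2, log (2 * sin θ) = 0 := by
  have hlog : (Set.Ioo 0 (Real.pi / 2)).EqOn (fun θ => log (2 * sin θ))
      fun θ => log 2 + log (sin θ) := fun θ hθ =>
    Real.log_mul two_ne_zero
      (Real.sin_pos_of_pos_of_lt_pi hθ.1 (by linarith [hθ.2, Real.pi_pos])).ne'
  rw [intervalIntegral.integral_congr_Ioo_of_le (by positivity) hlog,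
    intervalIntegral.integral_add (g := fun θ => log (sin θ)) intervalIntegrable_const
      intervalIntegrable_log_sin, integral_log_sin_zero_pi_div_two, intervalIntegral.integral_const,
    smul_eq_mul]
  ring

theorem hasDerivAt_cos_mul_two_mul_sin_mul_log {θ : ℝ} (hθ : 0 < sin θ) :
    HasDerivAt (fun θ => cos θ * (2 * sin θ * log (2 * sin θ)))
      (2 * cos (2 * θ) * log (2 * sin θ) + 2 * cos θ ^ 2) θ := by
  have hsin := (Real.hasDerivAt_sin θ).const_mul 2
  convert! (Real.hasDerivAt_cos θ).mul (hsin.mul (hsin.log (by positivity))) using 1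
  simp only [Pi.mul_apply]
  rw [Real.cos_two_mul']
  field_simp
  ring

theorem integral_cos_two_mul_mul_log_two_mul_sin :
    ∫ θ in 0..Real.pi / 2, 2 * cos (2 * θ) * log (2 * sin θ) = -Real.pi / 2 := by
  have hpi := Real.pi_pos
  have hcos : IntervalIntegrable (fun θ => 2 * cos θ ^ 2) volume 0 (Real.pi / 2) :=
    Continuous.intervalIntegrable (by fun_prop) _ _
  have hlog : IntervalIntegrable (fun θ => 2 * cos (2 * θ) * log (2 * sin θ)) volume 0
      (Real.pi / 2) := (intervalIntegrable_log_two_mul_sin _ _).continuousOn_mul (by fun_prop)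
  have hcont : Continuous fun θ => 2 * sin θ * log (2 * sin θ) :=
    Real.continuous_mul_log.comp (by fun_prop)
  have h := intervalIntegral.integral_eq_sub_of_hasDerivAt_of_le (by positivity)
    (Real.continuous_cos.mul hcont).continuousOn
    (fun θ hθ => hasDerivAt_cos_mul_two_mul_sin_mul_log
      (Real.sin_pos_of_pos_of_lt_pi hθ.1 (by linarith [hθ.2])))
    (hlog.add hcos)
  rw [intervalIntegral.integral_add hlog hcos, intervalIntegral.integral_const_mul,
    integral_cos_sq] at h
  simp only [Pi.mul_apply, Real.cos_pi_div_two, Real.sin_zero, mul_zero, zero_mul, sub_self] at h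
  linarith

theorem integral_sqrt_mul_log_zero_two :
    ∫ x in (0 : ℝ)..2, √(4 - x ^ 2) * log x = -Real.pi / 2 := by
  have hpi : 0 ≤ Real.pi / 2 := by positivity
  have hsubst := intervalIntegral.integral_comp_mul_deriv_of_deriv_nonneg
    (a := 0) (b := Real.pi / 2) (f := fun θ => 2 * sin θ) (f' := fun θ => 2 * cos θ)
    (g := fun x => √(4 - x ^ 2) * log x) (by fun_prop)
    (fun θ _ => (Real.hasDerivAt_sin θ).const_mul 2) (fun θ hθ => by
      rw [min_eq_left hpi, max_eq_right hpi] at hθ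
      have := Real.cos_nonneg_of_mem_Icc ⟨by linarith [hθ.1], hθ.2.le⟩
      positivity)
  have hintegrand : Set.EqOn
      (fun θ => ((fun x => √(4 - x ^ 2) * log x) ∘ fun θ => 2 * sin θ) θ * (2 * cos θ))
      (fun θ => 2 * cos (2 * θ) * log (2 * sin θ) + 2 * log (2 * sin θ))
      (Set.uIcc 0 (Real.pi / 2)) := fun θ hθ => by
    rw [Set.uIcc_of_le hpi] at hθ
    have hcos := Real.cos_nonneg_of_mem_Icc ⟨by linarith [hθ.1], hθ.2⟩
    have hsqrt : √(4 - (2 * sin θ) ^ 2) = 2 * cos θ := by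
      rw [← Real.sqrt_sq (by positivity : 0 ≤ 2 * cos θ)]
      congr 1
      linear_combination -4 * Real.sin_sq_add_cos_sq θ
    simp only [Function.comp_apply, hsqrt, Real.cos_two_mul]
    ring
  have hlog := intervalIntegrable_log_two_mul_sin 0 (Real.pi / 2)
  rw [intervalIntegral.integral_congr hintegrand, intervalIntegral.integral_add
      (hlog.continuousOn_mul (by fun_prop)) (hlog.const_mul 2),
    intervalIntegral.integral_const_mul, integral_cos_two_mul_mul_log_two_mul_sin,
    integral_log_two_mul_sin, mul_zero, add_zero] at hsubst
  simpa using hsubst.symm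

theorem integrable_log_wignerMeasure : Integrable log wignerMeasure :=
  integrable_wignerMeasure intervalIntegral.intervalIntegrable_log'

theorem integral_log_wignerMeasure : ∫ x, log x ∂wignerMeasure = -1 / 2 := by
  rw [integral_wignerMeasure_eq_div, intervalIntegral_neg_self_eq_two_smul_of_even (by simp)
    (intervalIntegral.intervalIntegrable_log'.continuousOn_mul (by fun_prop)),
    integral_sqrt_mul_log_zero_two, smul_eq_mul]
  field_simp [Real.pi_ne_zero]

end WignerLog

section SemicircleLaw

theorem integral_pow_semicircleLaw (β : ℝ) (k : ℕ) :
    ∫ x, x ^ k ∂(semicircleLaw β : Measure ℝ) = semicircleMoment k * β ^ k := by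
  refine (integral_map (by fun_prop) (by fun_prop)).trans ?_
  simp only [mul_pow]
  rw [integral_const_mul, integral_pow_wignerMeasure, mul_comm]

theorem ae_semicircleLaw_mem_Icc {β : ℝ} (hβ : β ∈ Set.Icc 0 1) :
    ∀ᵐ x ∂(semicircleLaw β : Measure ℝ), x ∈ Set.Icc (-2) 2 := by
  refine (ae_map_iff (by fun_prop) measurableSet_Icc).2 ?_
  filter_upwards [ae_wignerMeasure_mem_Icc] with x hx
  constructor <;> nlinarith [hx.1, hx.2, hβ.1, hβ.2]

theorem ae_semicircleLaw_ne_zero {β : ℝ} (hβ : β ≠ 0) :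
    ∀ᵐ x ∂(semicircleLaw β : Measure ℝ), x ≠ 0 := by
  refine (ae_map_iff (by fun_prop) (measurableSet_singleton 0).compl).2 ?_
  filter_upwards [ae_wignerMeasure_ne 0] with x hx using mul_ne_zero hβ hx

theorem log_mul_ae_wignerMeasure {β : ℝ} (hβ : β ≠ 0) :
    (fun x => Real.log (β * x)) =ᵐ[wignerMeasure] fun x => Real.log β + Real.log x := by
  filter_upwards [ae_wignerMeasure_ne 0] with x hx using Real.log_mul hβ hx

theorem integrable_log_semicircleLaw {β : ℝ} (hβ : β ≠ 0) :
    Integrable Real.log (semicircleLaw β : Measure ℝ) :=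
  (integrable_map_measure (by fun_prop) (by fun_prop)).2
    (((integrable_const _).add integrable_log_wignerMeasure).congr
      (log_mul_ae_wignerMeasure hβ).symm)

theorem integral_log_semicircleLaw {β : ℝ} (hβ : β ≠ 0) :
    ∫ x, Real.log x ∂(semicircleLaw β : Measure ℝ) = Real.log β - 1 / 2 := by
  refine (integral_map (by fun_prop) (by fun_prop)).trans ?_
  rw [integral_congr_ae (log_mul_ae_wignerMeasure hβ),
    integral_add (integrable_const _) integrable_log_wignerMeasure, integral_log_wignerMeasure,
    integral_const, probReal_univ, one_smul]
  ring

theorem semicircleLaw_zero : (semicircleLaw 0 : Measure ℝ) = Measure.dirac 0 := by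
  change wignerMeasure.map (fun x => 0 * x) = _
  simp

end SemicircleLaw

section ExtendedIntegral

variable {μ : Measure ℝ} {F : ℝ → EReal} {f : ℕ → ℝ → ℝ} {g : ℝ → ℝ}

theorem coe_integral_eq_extendedIntegral (hg : Integrable g μ) :
    ((∫ x, g x ∂μ : ℝ) : EReal) = extendedIntegral μ fun x => (g x : EReal) := by
  have hneg : ∫⁻ x, ENNReal.ofReal (-g x) ∂μ ≠ ⊤ := hg.neg.lintegral_lt_top.ne
  rw [extendedIntegral, integral_eq_lintegral_pos_part_sub_lintegral_neg_part hg, EReal.coe_sub,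
    EReal.coe_ennreal_toReal hg.lintegral_lt_top.ne, EReal.coe_ennreal_toReal hneg]
  rfl

theorem extendedIntegral_congr_ae {F' : ℝ → EReal} (h : F =ᵐ[μ] F') :
    extendedIntegral μ F = extendedIntegral μ F' := by
  have hpos : ∫⁻ x, (F x).toENNReal ∂μ = ∫⁻ x, (F' x).toENNReal ∂μ :=
    lintegral_congr_ae (h.fun_comp EReal.toENNReal)
  have hneg : ∫⁻ x, (-F x).toENNReal ∂μ = ∫⁻ x, (-F' x).toENNReal ∂μ :=
    lintegral_congr_ae (h.fun_comp fun y => (-y).toENNReal)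
  rw [extendedIntegral, extendedIntegral, hpos, hneg]

theorem tendsto_lintegral_ofReal_of_antitone (hf : ∀ m, Integrable (f m) μ)
    (hanti : ∀ᵐ x ∂μ, Antitone fun m => f m x)
    (hlim : ∀ᵐ x ∂μ, Tendsto (fun m => (f m x : EReal)) atTop (𝓝 (F x))) :
    Tendsto (fun m => ∫⁻ x, ENNReal.ofReal (f m x) ∂μ) atTop (𝓝 (∫⁻ x, (F x).toENNReal ∂μ)) := by
  refine lintegral_tendsto_of_tendsto_of_antitone
    (fun m => (hf m).aemeasurable.ennreal_ofReal) ?_ (hf 0).lintegral_lt_top.ne ?_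
  · filter_upwards [hanti] with x hx m n hmn using ENNReal.ofReal_le_ofReal (hx hmn)
  · filter_upwards [hlim] with x hx using (EReal.continuous_toENNReal.tendsto _).comp hx

theorem tendsto_lintegral_ofReal_neg_of_antitone (hf : ∀ m, AEMeasurable (f m) μ)
    (hanti : ∀ᵐ x ∂μ, Antitone fun m => f m x)
    (hlim : ∀ᵐ x ∂μ, Tendsto (fun m => (f m x : EReal)) atTop (𝓝 (F x))) :
    Tendsto (fun m => ∫⁻ x, ENNReal.ofReal (-f m x) ∂μ) atTop
      (𝓝 (∫⁻ x, (-F x).toENNReal ∂μ)) := by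
  refine lintegral_tendsto_of_tendsto_of_monotone
    (fun m => (hf m).neg.ennreal_ofReal) ?_ ?_
  · filter_upwards [hanti] with x hx m n hmn using
      ENNReal.ofReal_le_ofReal (neg_le_neg (hx hmn))
  · filter_upwards [hlim] with x hx using
      (EReal.continuous_toENNReal.tendsto _).comp ((continuous_neg.tendsto _).comp hx)

theorem tendsto_integral_extendedIntegral_of_antitone (hf : ∀ m, Integrable (f m) μ)
    (hanti : ∀ᵐ x ∂μ, Antitone fun m => f m x)
    (hlim : ∀ᵐ x ∂μ, Tendsto (fun m => (f m x : EReal)) atTop (𝓝 (F x))) :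
    Tendsto (fun m => ((∫ x, f m x ∂μ : ℝ) : EReal)) atTop (𝓝 (extendedIntegral μ F)) := by
  have hpos := tendsto_lintegral_ofReal_of_antitone hf hanti hlim
  have hneg := tendsto_lintegral_ofReal_neg_of_antitone (fun m => (hf m).aemeasurable) hanti hlim
  have hfin : ∫⁻ x, (F x).toENNReal ∂μ ≠ ⊤ := by
    refine ne_top_of_le_ne_top (hf 0).lintegral_lt_top.ne
      (le_of_tendsto hpos (Eventually.of_forall fun m => lintegral_mono_ae ?_))
    filter_upwards [hanti] with x hx using ENNReal.ofReal_le_ofReal (hx (Nat.zero_le m))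
  simp only [coe_integral_eq_extendedIntegral (hf _), extendedIntegral, sub_eq_add_neg]
  exact (EReal.continuousAt_add (p := (_, _)) (Or.inl (mt EReal.coe_ennreal_eq_top_iff.1 hfin))
    (Or.inl (EReal.coe_ennreal_ne_bot _))).tendsto.comp
      (((continuous_coe_ennreal_ereal.tendsto _).comp hpos).prodMk_nhds
        ((continuous_neg.tendsto _).comp ((continuous_coe_ennreal_ereal.tendsto _).comp hneg)))

theorem tendsto_integral_regularizedLogAbs [IsFiniteMeasure μ] {K : Set ℝ} (hK : IsCompact K)
    (hμ : ∀ᵐ x ∂μ, x ∈ K) :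
    Tendsto (fun m : ℕ => ((∫ x, regularizedLogAbs (1 / ((m : ℝ) + 1)) x ∂μ : ℝ) : EReal)) atTop
      (𝓝 (extendedIntegral μ extendedLogAbs)) := by
  have hε : Tendsto (fun m : ℕ => 1 / ((m : ℝ) + 1)) atTop (𝓝[>] 0) :=
    tendsto_nhdsWithin_iff.2 ⟨tendsto_one_div_add_atTop_nhds_zero_nat,
      Eventually.of_forall fun _ => Set.mem_Ioi.2 Nat.one_div_pos_of_nat⟩
  exact tendsto_integral_extendedIntegral_of_antitone
    (fun m => integrable_of_continuous_of_ae_mem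
      (continuous_regularizedLogAbs Nat.one_div_pos_of_nat) hK hμ)
    (Eventually.of_forall fun x _ _ hmn => regularizedLogAbs_le_regularizedLogAbs
      Nat.one_div_pos_of_nat (Nat.one_div_le_one_div hmn) x)
    (Eventually.of_forall fun x => (tendsto_regularizedLogAbs x).comp hε)

end ExtendedIntegral

theorem two_mul_extendedIntegral_semicircleLaw {α : ℝ} (hα : 0 ≤ α) :
    2 * extendedIntegral (semicircleLaw √α : Measure ℝ) extendedLogAbs =
      extendedLogAbs (α / Real.exp 1) := by
  rcases hα.eq_or_lt with rfl | hα
  · rw [Real.sqrt_zero, semicircleLaw_zero, extendedIntegral, zero_div, extendedLogAbs_zero]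
    simp [extendedLogAbs_zero, EReal.mul_bot_of_pos]
  · have hsqrt : √α ≠ 0 := (Real.sqrt_pos.2 hα).ne'
    have hae : extendedLogAbs =ᵐ[(semicircleLaw √α : Measure ℝ)]
        fun x => (Real.log x : EReal) := by
      filter_upwards [ae_semicircleLaw_ne_zero hsqrt] with x hx using extendedLogAbs_of_ne_zero hx
    rw [extendedIntegral_congr_ae hae,
      ← coe_integral_eq_extendedIntegral (integrable_log_semicircleLaw hsqrt),
      integral_log_semicircleLaw hsqrt, extendedLogAbs_of_ne_zero (by positivity),
      Real.log_div hα.ne' (Real.exp_ne_zero 1), Real.log_exp, Real.log_sqrt hα.le]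
    change ((2 : ℝ) : EReal) * _ = _
    rw [← EReal.coe_mul]
    ring_nf

section Limits

variable {V : ℕ → Type*} [∀ n, Fintype (V n)] [∀ n, Nonempty (V n)] {G : ∀ n, SimpleGraph (V n)}
  [∀ n, DecidableRel (G n).Adj] {d : ℕ → ℝ}

theorem eventually_log_totalMatchings_le (hadm : ∀ n, (G n).IsAdmissible (d n))
    (hd : Tendsto d atTop atTop) {ε : ℝ} (hε : 0 < ε) :
    ∀ᶠ n in atTop, Real.log (((G n).totalMatchings : ℝ) ^ (2 / (Fintype.card (V n) : ℝ)) / d n) ≤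
      2 * ∫ x, regularizedLogAbs ε x ∂(G n).matchingMeasure (d n) := by
  filter_upwards [hd.eventually_ge_atTop ε⁻¹] with n hn
  have hdn := pos_of_isAdmissible (hadm n)
  have hint {δ : ℝ} (hδ : 0 < δ) :
      Integrable (regularizedLogAbs δ) ((G n).matchingMeasure (d n)) :=
    have := isProbabilityMeasure_matchingMeasure (G n) (d n)
    integrable_of_continuous_of_ae_mem (continuous_regularizedLogAbs hδ) isCompact_Icc
      (ae_matchingMeasure_mem_Icc (hadm n))
  rw [log_totalMatchings_eq_integral hdn]
  gcongr 2 * ?_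
  exact integral_mono (hint (inv_pos.2 hdn)) (hint hε)
    (regularizedLogAbs_le_regularizedLogAbs (inv_pos.2 hdn) (inv_le_of_inv_le₀ hε hn))

theorem limsup_log_totalMatchings_le_integral (hadm : ∀ n, (G n).IsAdmissible (d n))
    (hd : Tendsto d atTop atTop) {ρ : ProbabilityMeasure ℝ}
    (hρ : ∀ᵐ x ∂(ρ : Measure ℝ), x ∈ Set.Icc (-2) 2)
    (hlim : Tendsto (fun n => matchingProbabilityMeasure (G n) (d n)) atTop (𝓝 ρ))
    {ε : ℝ} (hε : 0 < ε) :
    limsup (fun n => ((Real.log (((G n).totalMatchings : ℝ) ^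
        (2 / (Fintype.card (V n) : ℝ)) / d n) : ℝ) : EReal)) atTop ≤
      2 * ((∫ x, regularizedLogAbs ε x ∂(ρ : Measure ℝ) : ℝ) : EReal) := by
  have hint := tendsto_integral_of_ae_mem hlim (continuous_regularizedLogAbs hε) isCompact_Icc
    (fun n => ae_matchingMeasure_mem_Icc (hadm n)) hρ
  calc
    _ ≤ limsup (fun n =>
          ((2 * ∫ x, regularizedLogAbs ε x ∂(G n).matchingMeasure (d n) : ℝ) : EReal)) atTop :=
      limsup_le_limsup <| (eventually_log_totalMatchings_le hadm hd hε).mono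
        fun _ hn => EReal.coe_le_coe_iff.2 hn
    _ = ((2 * ∫ x, regularizedLogAbs ε x ∂(ρ : Measure ℝ) : ℝ) : EReal) :=
      ((continuous_coe_real_ereal.tendsto _).comp (hint.const_mul 2)).limsup_eq
    _ = 2 * ((∫ x, regularizedLogAbs ε x ∂(ρ : Measure ℝ) : ℝ) : EReal) := EReal.coe_mul _ _

theorem limsup_log_totalMatchings_le (hadm : ∀ n, (G n).IsAdmissible (d n))
    (hd : Tendsto d atTop atTop) {ρ : ProbabilityMeasure ℝ}
    (hρ : ∀ᵐ x ∂(ρ : Measure ℝ), x ∈ Set.Icc (-2) 2)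
    (hlim : Tendsto (fun n => matchingProbabilityMeasure (G n) (d n)) atTop (𝓝 ρ)) :
    limsup (fun n => ((Real.log (((G n).totalMatchings : ℝ) ^
        (2 / (Fintype.card (V n) : ℝ)) / d n) : ℝ) : EReal)) atTop ≤
      2 * extendedIntegral (ρ : Measure ℝ) extendedLogAbs :=
  ge_of_tendsto
    (EReal.Tendsto.const_mul (tendsto_integral_regularizedLogAbs isCompact_Icc hρ)
      (Or.inl (EReal.coe_ne_bot 2)) (Or.inl (EReal.coe_ne_top 2)))
    (Eventually.of_forall fun _ =>
      limsup_log_totalMatchings_le_integral hadm hd hρ hlim Nat.one_div_pos_of_nat)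

theorem sqrt_mem_Icc_zero_one {α : ℝ} (hα : α ∈ Set.Icc 0 1) : √α ∈ Set.Icc 0 1 :=
  ⟨Real.sqrt_nonneg α, Real.sqrt_le_one.2 hα.2⟩

theorem tendsto_matchingProbabilityMeasure_semicircleLaw (hadm : ∀ n, (G n).IsAdmissible (d n))
    (hd : Tendsto d atTop atTop) {α : ℝ} (hα : α ∈ Set.Icc 0 1) (h : IsAsympRegular G d α) :
    Tendsto (fun n => matchingProbabilityMeasure (G n) (d n)) atTop (𝓝 (semicircleLaw √α)) := by
  refine tendsto_of_tendsto_moments (fun n => ae_matchingMeasure_mem_Icc (hadm n))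
    (ae_semicircleLaw_mem_Icc (sqrt_mem_Icc_zero_one hα)) fun k => ?_
  rw [integral_pow_semicircleLaw]
  exact tendsto_moment_matchingMeasure hadm hd (tendsto_average_branchCoeff hadm hα h k)

theorem limsup_coe_le_of_limsup_log_le {ι : Type*} {l : Filter ι} {a : ι → ℝ}
    (ha : ∀ i, 0 < a i) {c : ℝ} (hc : 0 ≤ c)
    (h : limsup (fun i => (Real.log (a i) : EReal)) l ≤ extendedLogAbs c) :
    limsup (fun i => (a i : EReal)) l ≤ c := by
  refine EReal.le_of_forall_lt_iff_le.1 fun b hb => limsup_le_of_le (h := ?_)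
  have hcb : c < b := EReal.coe_lt_coe_iff.1 hb
  have hb0 : 0 < b := hc.trans_lt hcb
  have hlog : extendedLogAbs c < (Real.log b : EReal) := by
    rcases hc.eq_or_lt with rfl | hc
    · exact extendedLogAbs_zero ▸ EReal.bot_lt_coe _
    · rw [extendedLogAbs_of_ne_zero hc.ne']
      exact EReal.coe_lt_coe_iff.2 (Real.log_lt_log hc hcb)
  filter_upwards [eventually_lt_of_limsup_lt (h.trans_lt hlog)] with i hi
  exact EReal.coe_le_coe_iff.2
    ((Real.log_lt_log_iff (ha i) hb0).1 (EReal.coe_lt_coe_iff.1 hi)).le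

theorem limsup_totalMatchings_le (hadm : ∀ n, (G n).IsAdmissible (d n))
    (hd : Tendsto d atTop atTop) {α : ℝ} (hα : α ∈ Set.Icc 0 1) (h : IsAsympRegular G d α) :
    limsup (fun n => ((((G n).totalMatchings : ℝ) ^
        (2 / (Fintype.card (V n) : ℝ)) / d n : ℝ) : EReal)) atTop ≤
      ((α / Real.exp 1 : ℝ) : EReal) := by
  refine limsup_coe_le_of_limsup_log_le (fun n => ?_) (div_nonneg hα.1 (Real.exp_nonneg 1)) ?_
  · exact div_pos (Real.rpow_pos_of_pos (Nat.cast_pos.2 (totalMatchings_pos (G n))) _)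
      (pos_of_isAdmissible (hadm n))
  · rw [← two_mul_extendedIntegral_semicircleLaw hα.1]
    exact limsup_log_totalMatchings_le hadm hd
      (ae_semicircleLaw_mem_Icc (sqrt_mem_Icc_zero_one hα))
      (tendsto_matchingProbabilityMeasure_semicircleLaw hadm hd hα h)

end Limits

end MatchingMeasure

theorem mainTheorem4 {V : ℕ → Type*} [∀ n, Fintype (V n)] [∀ n, Nonempty (V n)]
    (G : ∀ n, SimpleGraph (V n)) [∀ n, DecidableRel (G n).Adj] (d : ℕ → ℝ)
    (hadm : ∀ n, (G n).IsAdmissible (d n)) (hd : Tendsto d atTop atTop) :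
    (∀ n, IsProbabilityMeasure ((G n).matchingMeasure (d n))) ∧
    (TreeDensitiesConverge G d →
      ∃ ρ : ProbabilityMeasure ℝ,
        (ρ : Measure ℝ) (Set.Icc (-2) 2)ᶜ = 0 ∧
        Tendsto (fun n => (G n).matchingFiniteMeasure (d n)) atTop (𝓝 ρ.toFiniteMeasure) ∧
        limsup (fun n => ((Real.log (((G n).totalMatchings : ℝ) ^
            ((2 : ℝ) / (Fintype.card (V n) : ℝ)) / d n) : ℝ) : EReal)) atTop ≤
          2 * extendedIntegral ((ρ : Measure ℝ).restrict (Set.Icc (-2) 2)) extendedLogAbs) ∧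
    (∀ α : ℝ, 0 ≤ α → α ≤ 1 → IsAsympRegular G d α →
      Tendsto (fun n => (G n).matchingFiniteMeasure (d n)) atTop
        (𝓝 (semicircleLaw (√α)).toFiniteMeasure) ∧
      limsup (fun n => ((((G n).totalMatchings : ℝ) ^
          ((2 : ℝ) / (Fintype.card (V n) : ℝ)) / d n : ℝ) : EReal)) atTop ≤
        ((α / Real.exp 1 : ℝ) : EReal)) := by
  refine ⟨fun n => MatchingMeasure.isProbabilityMeasure_matchingMeasure (G n) (d n), fun h => ?_,
    fun α h0 h1 h => ⟨?_, MatchingMeasure.limsup_totalMatchings_le hadm hd ⟨h0, h1⟩ h⟩⟩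
  · obtain ⟨ρ, hρ, hlim⟩ := MatchingMeasure.exists_tendsto_matchingProbabilityMeasure hadm hd h
    refine ⟨ρ, hρ, (ProbabilityMeasure.tendsto_nhds_iff_toFiniteMeasure_tendsto_nhds _).1 hlim, ?_⟩
    rw [Measure.restrict_eq_self_of_ae_mem hρ]
    exact MatchingMeasure.limsup_log_totalMatchings_le hadm hd hρ hlim
  · exact (ProbabilityMeasure.tendsto_nhds_iff_toFiniteMeasure_tendsto_nhds _).1
      (MatchingMeasure.tendsto_matchingProbabilityMeasure_semicircleLaw hadm hd ⟨h0, h1⟩ h)
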